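/- Let $q=2^m$ with $m\ge 1$, and let $G$ be a finite special $2$-group, that is, a finite $2$-group whose Frattini subgroup, commutator subgroup and center coincide; let $Z$ be the center and $G^{\mathrm{ab}}=G/Z$ the abelianization. Suppose that every noncentral element of $G$ has order four, and that $Z$ and $G^{\mathrm{ab}}$ are endowed with structures of $\mathbb{F}_q$-vector spaces such that $\dim_{\mathbb{F}_q}(Z)=1$ and the commutator pairing $G^{\mathrm{ab}}\times G^{\mathrm{ab}}\to Z$, $(\bar a,\bar b)\mapsto aba^{-1}b^{-1}$, is $\mathbb{F}_q$-bilinear. Choose a Lagrangian (a totally isotropic $\mathbb{F}_q$-subspace of maximal dimension) in $G^{\mathrm{ab}}$ and let $H\subset G$ be its preimage; thus $Z\subset H$. For an elementary abelian $2$-group $A$ let $\mathbb{P}(A)$ be the set of $\mathbb{F}_2$-hyperplanes (subgroups of index two) in $A$. For each $x\in\mathbb{P}(Z)$ choose a homomorphism $\tilde\chi_x:H\to\mathbb{Q}(i)^\times$ whose restriction to $Z$ has kernel $x$, and let $$2V_x=\mathrm{ind}_H^G(\mathbb{Q}(i),\tilde\chi_x),$$ a representation of $G$ over $\mathbb{Q}$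 (here $2V_x$ is just a formal symbol). For each $y\in\mathbb{P}(G^{\mathrm{ab}})$ let $\varphi_y:G^{\mathrm{ab}}\to\mathbb{Q}^\times$ be the homomorphism with kernel $y$, and let $W_y=(\mathbb{Q},\varphi_y)$ be the corresponding one-dimensional representation of $G$. Let $\mathbb{Q}$ denote the trivial representation. For a field $K$, a family of finite-dimensional irreducible representations of $G$ over $K$ is called a basic set of irreducible representations if every finite-dimensional irreducible representation of $G$ over $K$ is isomorphic to exactly one member of the family. Then the representations $2V_x$, $x\in\mathbb{P}(Z)$, and $W_y$, $y\in\mathbb{P}(G^{\mathrm{ab}})$, and $\mathbb{Q}$ form a basic set of irreducible representations of $G$ over $\mathbb{Q}$, and for every $x\in\mathbb{P}(Z)$ the endomorphism algebra $\mathrm{End}(2V_x)$ is isomorphic to the quaternion algebra $(-1,-1)_{\mathbb{Q}}$. Moreover, for every field extension $\mathbb{Q}\subset K$, the representations obtained from them by extension of scalars to $K$ form a basic set of irreducible representations of $G$ over $K$ if and only if the equation $T_0^2+T_1^2+T_2^2=0$ has no nontrivial solution in $K$. -/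

import Mathlib

open scoped TensorProduct Quaternion IntermediateField IsMulCommutative

universe u v w

noncomputable section

/-- A `p`-group is special if its Frattini subgroup, its commutator subgroup and its center
coincide. -/
structure IsSpecialPGroup (p : ℕ) (G : Type*) [Group G] : Prop where
  isPGroup : IsPGroup p G
  frattini_eq : frattini G = commutator G
  commutator_eq : commutator G = Subgroup.center G

/-- The subgroups of index `p`. For an elementary abelian `p`-group `A`, that is, a vector space
over the field with `p` elements, these are the `𝔽_p`-hyperplanes, or in Grothendieck's convention
the rational points of the projective space `ℙ(A)`. -/
abbrev Hyperplane (p : ℕ) (A : Type*) [Group A] : Type _ := {x : Subgroup A // x.index = p}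

section Lagrangian

variable {F A C : Type*} [Field F] [AddCommGroup A] [Module F A] [AddCommGroup C] [Module F C]

/-- All values of the pairing `B` on the subspace `L` vanish. -/
def IsTotallyIsotropic (B : A →ₗ[F] A →ₗ[F] C) (L : Submodule F A) : Prop :=
  ∀ a ∈ L, ∀ b ∈ L, B a b = 0

/-- A Lagrangian is a totally isotropic subspace of maximal dimension. -/
def IsLagrangian (B : A →ₗ[F] A →ₗ[F] C) (L : Submodule F A) : Prop :=
  IsTotallyIsotropic B L ∧
    ∀ L' : Submodule F A, IsTotallyIsotropic B L' → Module.finrank F L' ≤ Module.finrank F L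

end Lagrangian

section Preimage

variable {F G : Type*} [Field F] [Group G] [Module F (Additive (Abelianization G))]

/-- The preimage in `G` of a subspace of the abelianization of `G`. -/
def abPreimage (L : Submodule F (Additive (Abelianization G))) : Subgroup G :=
  (AddSubgroup.toSubgroup' L.toAddSubgroup).comap Abelianization.of

theorem mem_abPreimage (L : Submodule F (Additive (Abelianization G))) (g : G) :
    g ∈ abPreimage L ↔ Additive.ofMul (Abelianization.of g) ∈ L :=
  Iff.rfl

theorem IsSpecialPGroup.center_le {p : ℕ} (hG : IsSpecialPGroup p G)
    (L : Submodule F (Additive (Abelianization G))) : Subgroup.center G ≤ abPreimage L := by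
  intro g hg
  rw [← hG.commutator_eq] at hg
  have h1 : Abelianization.of g = 1 := (QuotientGroup.eq_one_iff g).2 hg
  rw [mem_abPreimage, h1, ofMul_one]
  exact L.zero_mem

end Preimage

section Representations

/-- For a field extension `k ⊆ E` and a homomorphism `φ : G → Eˣ`, the `k`-linear representation
of `G` on `E` in which `g` acts as multiplication by `φ g`. -/
def charRep (k : Type*) {G E : Type*} [Field k] [Field E] [Algebra k E] [Group G]
    (φ : G →* Eˣ) : Representation k G E where
  toFun g := LinearMap.mulLeft k (φ g : E)
  map_one' := by ext; simp
  map_mul' g h := by ext; simp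

/-- A representation, transported to a copy of its underlying space in a larger universe. -/
def uliftRep {k : Type*} {G : Type*} {V : Type v} [Field k] [Group G] [AddCommGroup V] [Module k V]
    (ρ : Representation k G V) : Representation k G (ULift.{w} V) where
  toFun g := ULift.moduleEquiv.symm.toLinearMap ∘ₗ ρ g ∘ₗ ULift.moduleEquiv.toLinearMap
  map_one' := by ext; simp
  map_mul' g h := by ext; simp

/-- The representation `K ⊗ V` over `K` obtained from a `k`-linear representation on `V` by
extension of scalars. -/
def extendScalars {k : Type u} (K : Type v) {G : Type*} [Field k] [Field K] [Algebra k K] [Group G]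
    (V : Rep.{w} k G) : Rep.{max v w} K G :=
  Rep.of (X := K ⊗[k] V.V)
    { toFun := fun g => (V.ρ g).baseChange K
      map_one' := by ext; simp
      map_mul' := fun g h => by ext; simp }

/-- The family `V` is a basic set of irreducible representations of `G` over `K`: the `V i` are
finite-dimensional and irreducible, and every finite-dimensional irreducible representation is
isomorphic to `V i` for exactly one `i`. (Every finite-dimensional vector space over `K` has a copy
in the universe of `K`.) -/
structure IsBasicSet {K : Type u} {G : Type v} [Field K] [Group G] {ι : Type*}
    (V : ι → Rep.{w} K G) : Prop where
  finiteDimensional : ∀ i, FiniteDimensional K (V i).V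
  irreducible : ∀ i, (V i).ρ.IsIrreducible
  pairwise : ∀ i j, Nonempty ((V i).ρ.Equiv (V j).ρ) → i = j
  exhaustive : ∀ (W : Type u) [AddCommGroup W] [Module K W] [FiniteDimensional K W]
    (σ : Representation K G W), σ.IsIrreducible → ∃ i, Nonempty (σ.Equiv (V i).ρ)

/-- The field `ℚ(i)`, as a subfield of `ℂ`. -/
abbrev GaussianField : Type := ℚ⟮Complex.I⟯

variable {G : Type u} [Group G]

/-- The representation `2V_x = ind_H^G (ℚ(i), χ)` over `ℚ`, for a homomorphism `χ : H → ℚ(i)ˣ`.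
The symbol `2V` is formal. -/
def repTwoV {H : Subgroup G} (χ : H →* GaussianFieldˣ) : Rep.{u} ℚ G :=
  Rep.of ((charRep ℚ χ).ind H.subtype)

/-- The representation `W_y = (ℚ, φ)` attached to a homomorphism `φ : Gᵃᵇ → ℚˣ`. -/
def repW (φ : Abelianization G →* ℚˣ) : Rep.{u} ℚ G :=
  Rep.of (uliftRep.{0, u} (charRep ℚ (φ.comp Abelianization.of)))

/-- The trivial representation `ℚ`. -/
def repTrivial (G : Type u) [Group G] : Rep.{u} ℚ G :=
  Rep.of (uliftRep.{0, u} (Representation.trivial ℚ G ℚ))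

/-- The family consisting of the `2V_x`, the `W_y` and the trivial representation `ℚ`. -/
def rationalFamily {X Y : Type*} {H : Subgroup G} (χ : X → (H →* GaussianFieldˣ))
    (φ : Y → (Abelianization G →* ℚˣ)) : X ⊕ Y ⊕ Unit → Rep.{u} ℚ G :=
  Sum.elim (fun x => repTwoV (χ x)) (Sum.elim (fun y => repW (φ y)) (fun _ => repTrivial G))

end Representations

end

/-! Squaring induces a map `Q` from `Gᵃᵇ` to `Z`. It is quadratic with polar form the commutator
pairing `B`, and anisotropic because noncentral elements have order four. Fix a hyperplane `x` of
`Z` with sign character `lam`. As `B` is `F`-bilinear and `Z` is an `F`-line, `lam ∘ B` is still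
nondegenerate and the Lagrangian `L` is still its own orthogonal.

Two counts now locate a quaternion group. On `L` the map `Q` is additive and injective, and `|L| ≥
|F| = |Z|`, so `Q` maps `L` onto `Z`; hence `χ` takes the value `i` at some `h₀` in `H`
(`IsLagrangian.exists_quadratic_eq`). Each nontrivial coset of `L` yields its own nonzero character
`f` of `Z` with `f (B v l) = f (Q l)` on `L` and `f (Q v) = 1`; since `|Gᵃᵇ/L| ≥ |Z|`, every nonzero
`f` arises (`IsLagrangian.exists_forall_character_eq`), and the one given by `lam` supplies `g₀`.
Then `h₀` and `g₀` have squares and commutator of sign `-1`, and with `N = ker χ` and `Z` they make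
up the orthogonal of `N` (`IsSpecialPGroup.exists_polarization`).

Let `Z` act on a nonzero `W` by `lam`. Averaging over `N` gives a nonzero `N`-fixed vector
(`exists_fixed`), and Frobenius reciprocity turns any such vector `w` into a map from `K ⊗ 2V_x` to
`W` sending the generator `u₀` to `w`. So endomorphisms of `K ⊗ 2V_x` correspond to its `N`-fixed
vectors, which are spanned by `u₀`, `h₀u₀`, `g₀u₀`, `g₀h₀u₀`: they come from the quaternions
`(-1,-1)_K`. The norm form, a sum of four squares, is anisotropic exactly when the sum of three
squares is. In that case nonzero quaternions act invertibly, so `K ⊗ 2V_x` is irreducible, and it is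
the only irreducible representation with central character `lam`. Otherwise a pure quaternion of
norm zero acts as a nonzero nilpotent endomorphism.

Irreducible representations with trivial central action factor through `Gᵃᵇ`, which has exponent
two, and are the `W_y` and the trivial one. The statement over `ℚ` is the case `K = ℚ`. -/

/-! ### Anisotropic quadratic maps and Lagrangians in characteristic two. -/

section QuadraticMap

variable {F V Z : Type*} [Field F] [AddCommGroup V] [Module F V] [AddCommGroup Z] [Module F Z]
  {B : V →ₗ[F] V →ₗ[F] Z} {L : Submodule F V}

/-- A Lagrangian of an alternating form contains its orthogonal. -/
theorem IsLagrangian.mem_of_orthogonal [Finite V] (hL : IsLagrangian B L) (halt : B.IsAlt) {a : V}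
    (ha : ∀ l ∈ L, B a l = 0) : a ∈ L := by
  -- Adding `a` keeps the subspace isotropic because `B` is alternating; maximality of `L` then
  -- gives equality.
  have hiso : IsTotallyIsotropic B (L ⊔ F ∙ a) := by
    intro u hu v hv
    obtain ⟨l, hl, _, hc, rfl⟩ := Submodule.mem_sup.1 hu
    obtain ⟨l', hl', _, hd, rfl⟩ := Submodule.mem_sup.1 hv
    obtain ⟨c, rfl⟩ := Submodule.mem_span_singleton.1 hc
    obtain ⟨d, rfl⟩ := Submodule.mem_span_singleton.1 hd
    have h1 : B l a = 0 := by rw [← halt.neg, ha l hl, neg_zero]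
    have h2 : B a a = 0 := halt a
    simp [hL.1 l hl l' hl', ha l' hl', h1, h2]
  have := Submodule.eq_of_le_of_finrank_le (le_sup_left : L ≤ L ⊔ F ∙ a) (hL.2 _ hiso)
  rw [this]
  exact Submodule.mem_sup_right (Submodule.mem_span_singleton_self a)

/-- If a nonzero character kills the values `B a l`, `l ∈ S`, then these values vanish. -/
theorem eq_zero_of_forall_character_eq_zero (hdim : Module.finrank F Z = 1) {f : Z →+ ZMod 2}
    (hf : f ≠ 0) (S : Submodule F V) {a : V} (ha : ∀ l ∈ S, f (B a l) = 0) :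
    ∀ l ∈ S, B a l = 0 := by
  intro l hl
  by_contra h
  refine hf (AddMonoidHom.ext fun z => ?_)
  obtain ⟨c, rfl⟩ := exists_smul_eq_of_finrank_eq_one hdim h z
  rw [← map_smul]
  exact ha _ (S.smul_mem c hl)

/-- The values `B a l`, `l ∈ L`, form an `F`-subspace of the line `Z`, so a nonzero `f` kills them
only if they vanish; `L` thus remains its own orthogonal for `f ∘ B`. -/
theorem IsLagrangian.mem_of_forall_character_eq_zero [Finite V] (hL : IsLagrangian B L)
    (halt : B.IsAlt) (hdim : Module.finrank F Z = 1) {f : Z →+ ZMod 2} (hf : f ≠ 0) {a : V}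
    (ha : ∀ l ∈ L, f (B a l) = 0) : a ∈ L :=
  hL.mem_of_orthogonal halt (eq_zero_of_forall_character_eq_zero hdim hf L ha)

theorem exists_character_ne_zero (hdim : Module.finrank F Z = 1) {f : Z →+ ZMod 2}
    (hf : f ≠ 0) {a : V} (ha : ∃ b, B a b ≠ 0) : ∃ b, f (B a b) ≠ 0 := by
  by_contra! h
  obtain ⟨b, hb⟩ := ha
  exact hb (eq_zero_of_forall_character_eq_zero hdim hf ⊤ (fun l _ => h l) b trivial)

theorem Module.natCard_le_of_nontrivial (F M : Type*) [Field F] [AddCommGroup M] [Module F M]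
    [Finite M] [Nontrivial M] : Nat.card F ≤ Nat.card M := by
  obtain ⟨m, hm⟩ := exists_ne (0 : M)
  exact Nat.card_le_card_of_injective _ (smul_left_injective F hm)

variable [CharP F 2]

include F in
theorem add_self_of_charP_two (z : Z) : z + z = 0 := by
  rw [← two_smul F z, CharTwo.two_eq_zero, zero_smul]

variable [Finite V] {Q : V → Z}

/-- An anisotropic quadratic map with values in a line maps a Lagrangian of its polar form onto
that line. -/
theorem IsLagrangian.exists_quadratic_eq [Finite Z] [Nontrivial V] (hL : IsLagrangian B L)
    (halt : B.IsAlt) (hdim : Module.finrank F Z = 1)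
    (hQ : ∀ a b, Q (a + b) = Q a + Q b + B a b) (hQ0 : ∀ a, Q a = 0 → a = 0) (z : Z) :
    ∃ l ∈ L, Q l = z := by
  have hLne : Nontrivial L := by
    rw [Submodule.nontrivial_iff_ne_bot]
    rintro rfl
    obtain ⟨a, ha⟩ := exists_ne (0 : V)
    refine ha ((Submodule.mem_bot F).1 (hL.mem_of_orthogonal halt fun l hl => ?_))
    rw [(Submodule.mem_bot F).1 hl, map_zero]
  -- On the isotropic `L` the map `Q` is additive, and it has trivial kernel by anisotropy.
  have hinj : Function.Injective fun l : L => Q l := by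
    intro l l' h
    have h1 : Q (l + l' : V) = 0 := by
      rw [hQ, hL.1 l l.2 l' l'.2, add_zero]
      change Q l = Q l' at h
      rw [h, add_self_of_charP_two (F := F)]
    have h2 := hQ0 _ h1
    have h3 := add_self_of_charP_two (F := F) (l' : V)
    exact Subtype.ext (add_right_cancel (h2.trans h3.symm))
  have hcard : Nat.card Z = Nat.card F := by
    rw [Module.natCard_eq_pow_finrank (K := F), hdim, pow_one]
  obtain ⟨l, hl⟩ := (hinj.bijective_of_nat_card_le
    (hcard.trans_le (Module.natCard_le_of_nontrivial F L))).2 z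
  exact ⟨l, l.2, hl⟩

omit [Finite V] in
/-- For a vector `v` outside of a Lagrangian, some character kills all `B v l + Q l` but not
`Q v`. -/
theorem IsLagrangian.exists_character (hL : IsLagrangian B L)
    (hQ : ∀ a b, Q (a + b) = Q a + Q b + B a b) (hQ0 : ∀ a, Q a = 0 → a = 0) {v : V} (hv : v ∉ L) :
    ∃ f : Z →+ ZMod 2, (∀ l ∈ L, f (B v l) = f (Q l)) ∧ f (Q v) = 1 := by
  have h2 : ∀ z : Z, z + z = 0 := add_self_of_charP_two (F := F)
  let _ : Module (ZMod 2) Z := AddCommGroup.zmodModule fun z => by rw [two_nsmul, h2]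
  have hz : Q 0 = 0 := by
    have := hQ 0 0
    rw [add_zero, map_zero, add_zero, h2] at this
    exact this
  let T : L →+ Z :=
    { toFun := fun l => B v l + Q l
      map_zero' := by simp [hz]
      map_add' := fun l l' => by
        rw [Submodule.coe_add, hQ, hL.1 l l.2 l' l'.2, map_add, add_zero]
        abel }
  -- `B v l + Q l = Q v` would give `Q (v + l) = 0`, hence `v ∈ L`.
  have hT : Q v ∉ AddSubgroup.toZModSubmodule 2 T.range := by
    rintro ⟨l, hl⟩
    have h0 : Q (v + l) = 0 := by
      have hl' : B v l + Q l = Q v := hl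
      rw [hQ, ← hl', add_assoc, add_comm (Q l) (B v l), h2]
    refine hv ?_
    rw [eq_neg_of_add_eq_zero_left (hQ0 _ h0)]
    exact L.neg_mem l.2
  obtain ⟨f, hf, hfT⟩ := Submodule.exists_le_ker_of_notMem hT
  refine ⟨f.toAddMonoidHom, fun l hl => ?_, ?_⟩
  · have h : f (B v l + Q l) = 0 := hfT (⟨⟨l, hl⟩, rfl⟩ : B v l + Q l ∈ T.range)
    rw [map_add] at h
    exact CharTwo.add_eq_zero.1 h
  · have : ∀ x : ZMod 2, x ≠ 0 → x = 1 := by decide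
    exact this _ hf

theorem natCard_addMonoidHom_zmod_two [Finite Z] (h : ∀ z : Z, z + z = 0) :
    Nat.card (Z →+ ZMod 2) = Nat.card Z := by
  let _ : Module (ZMod 2) Z := AddCommGroup.zmodModule fun z => by rw [two_nsmul, h]
  rw [Nat.card_congr (AddMonoidHom.toZModLinearMapEquiv 2 (M := Z) (M₁ := ZMod 2)).toEquiv,
    Module.natCard_eq_pow_finrank (K := ZMod 2),
    Module.natCard_eq_pow_finrank (K := ZMod 2) (V := Z)]
  congr 1
  exact Subspace.dual_finrank_eq

/-- For an anisotropic quadratic map with values in a line, every nonzero character of the line is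
one of those of `IsLagrangian.exists_character`. -/
theorem IsLagrangian.exists_forall_character_eq [Finite Z] [Nontrivial V] (hL : IsLagrangian B L)
    (halt : B.IsAlt) (hnd : ∀ a, (∀ b, B a b = 0) → a = 0) (hdim : Module.finrank F Z = 1)
    (hQ : ∀ a b, Q (a + b) = Q a + Q b + B a b) (hQ0 : ∀ a, Q a = 0 → a = 0) {f : Z →+ ZMod 2}
    (hf : f ≠ 0) : ∃ v, (∀ l ∈ L, f (B v l) = f (Q l)) ∧ f (Q v) = 1 := by
  classical
  have hex : ∀ c : V ⧸ L, c ≠ 0 → ∃ f : Z →+ ZMod 2,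
      (∀ l ∈ L, f (B c.out l) = f (Q l)) ∧ f (Q c.out) = 1 := fun c hc => by
    refine hL.exists_character hQ hQ0 fun h => hc ?_
    rw [← Submodule.Quotient.mk_out c]
    exact (Submodule.Quotient.mk_eq_zero L).2 h
  choose! Φ hΦ hΦ1 using hex
  -- One character per coset. Representatives with the same character differ by a vector orthogonal
  -- to `L` for `f ∘ B`, so `Ψ` is injective, and onto by counting.
  let Ψ : V ⧸ L → (Z →+ ZMod 2) := fun c => if c = 0 then 0 else Φ c
  have hne : ∀ c, c ≠ 0 → Φ c ≠ 0 := fun c hc h => by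
    have := hΦ1 c hc
    simp [h] at this
  have hinj : Function.Injective Ψ := by
    intro c d h
    by_cases hc : c = 0 <;> by_cases hd : d = 0
    · rw [hc, hd]
    · simp only [Ψ, hc, hd, if_true, if_false] at h
      exact absurd h.symm (hne d hd)
    · simp only [Ψ, hc, hd, if_true, if_false] at h
      exact absurd h (hne c hc)
    · simp only [Ψ, hc, hd, if_false] at h
      have : c.out - d.out ∈ L := by
        refine hL.mem_of_forall_character_eq_zero halt hdim (hne c hc) fun l hl => ?_
        rw [map_sub, LinearMap.sub_apply, map_sub, hΦ c hc l hl, h, hΦ d hd l hl, sub_self]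
      rw [← Submodule.Quotient.mk_out c, ← Submodule.Quotient.mk_out d]
      exact (Submodule.Quotient.eq L).2 this
  have hVL : Nontrivial (V ⧸ L) := by
    rw [Submodule.Quotient.nontrivial_iff]
    rintro rfl
    obtain ⟨a, ha⟩ := exists_ne (0 : V)
    exact ha (hnd a fun b => hL.1 a trivial b trivial)
  have : Finite (V ⧸ L) := Finite.of_surjective _ (Submodule.mkQ_surjective L)
  have hcard : Nat.card (Z →+ ZMod 2) ≤ Nat.card (V ⧸ L) := by
    rw [natCard_addMonoidHom_zmod_two (add_self_of_charP_two (F := F)),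
      Module.natCard_eq_pow_finrank (K := F), hdim, pow_one]
    exact Module.natCard_le_of_nontrivial F (V ⧸ L)
  have : Finite (Z →+ ZMod 2) := DFunLike.finite _
  obtain ⟨c, hc⟩ := (hinj.bijective_of_nat_card_le hcard).2 f
  have hc0 : c ≠ 0 := by
    rintro rfl
    exact hf (by rw [← hc]; simp [Ψ])
  simp only [Ψ, hc0, if_false] at hc
  subst hc
  exact ⟨c.out, hΦ c hc0, hΦ1 c hc0⟩

end QuadraticMap

/-! ### Fixed vectors of `N` when the center acts by a sign. -/

section PolarizedCharacter

/-- A sign character `lam` of the center of `G` with the pairing `β` that it induces on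
commutators, a subgroup `N` on which the character is trivial, and two elements `h₀`, `g₀` which
generate the orthogonal of `N` modulo `N` and the center and which anticommute with squares of sign
`-1`. -/
structure IsQuaternionicPolarization {G : Type*} [Group G] (lam : Subgroup.center G →* ℤˣ)
    (β : G →* G →* ℤˣ) (N : Subgroup G) (h₀ g₀ : G) : Prop where
  commutator_eq : ∀ g h, ∃ z : Subgroup.center G, (z : G) = g * h * g⁻¹ * h⁻¹ ∧ lam z = β g h
  nondegenerate : ∀ n, (∀ g, β g n = 1) → n ∈ Subgroup.center G
  lam_eq_one : ∀ z : Subgroup.center G, (z : G) ∈ N → lam z = 1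
  sq_h₀ : ∃ z : Subgroup.center G, (z : G) = h₀ * h₀ ∧ lam z = -1
  sq_g₀ : ∃ z : Subgroup.center G, (z : G) = g₀ * g₀ ∧ lam z = -1
  orthogonal_h₀ : ∀ n ∈ N, β n h₀ = 1
  orthogonal_g₀ : ∀ n ∈ N, β n g₀ = 1
  anticommute : β h₀ g₀ = -1
  orthogonal : ∀ g, (∀ n ∈ N, β n g = 1) → ∃ z : Subgroup.center G, ∃ n ∈ N,
    g = n * z ∨ g = h₀ * n * z ∨ g = g₀ * n * z ∨ g = g₀ * h₀ * n * z

variable {K G W : Type*} [Field K] [Group G] [AddCommGroup W] [Module K W]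

/-- The center acts by the sign character `lam`. -/
def HasCentralSign (ρ : Representation K G W) (lam : Subgroup.center G →* ℤˣ) : Prop :=
  ∀ (z : Subgroup.center G) (w : W), ρ z w = lam z • w

namespace IsQuaternionicPolarization

variable {lam : Subgroup.center G →* ℤˣ} {β : G →* G →* ℤˣ} {N : Subgroup G} {h₀ g₀ : G}
  (hP : IsQuaternionicPolarization lam β N h₀ g₀) {ρ : Representation K G W}
  (hρ : HasCentralSign ρ lam)

include hP hρ

theorem apply_apply_comm (g h : G) (w : W) : ρ g (ρ h w) = β g h • ρ h (ρ g w) := by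
  obtain ⟨z, hz, hl⟩ := hP.commutator_eq g h
  rw [← hl, ← hρ, hz, ← Module.End.mul_apply, ← Module.End.mul_apply, ← Module.End.mul_apply,
    ← map_mul, ← map_mul, ← map_mul]
  congr 2
  group

theorem apply_h₀_h₀ (w : W) : ρ h₀ (ρ h₀ w) = -w := by
  obtain ⟨z, hz, hl⟩ := hP.sq_h₀
  rw [← Module.End.mul_apply, ← map_mul, ← hz, hρ, hl]
  simp

theorem apply_g₀_g₀ (w : W) : ρ g₀ (ρ g₀ w) = -w := by
  obtain ⟨z, hz, hl⟩ := hP.sq_g₀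
  rw [← Module.End.mul_apply, ← map_mul, ← hz, hρ, hl]
  simp

theorem apply_h₀_g₀ (w : W) : ρ h₀ (ρ g₀ w) = -ρ g₀ (ρ h₀ w) := by
  rw [hP.apply_apply_comm hρ, hP.anticommute]
  simp

/-- The sum of `ρ n` over `N` projects, up to a scalar, onto the fixed vectors. Its average over
`G`-conjugates is a positive scalar: noncentral `n` contribute a nontrivial sign sum, which is zero,
while central `n` act trivially. -/
theorem exists_fixed [Finite G] [CharZero K] [Nontrivial W] :
    ∃ w : W, w ≠ 0 ∧ ∀ n ∈ N, ρ n w = w := by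
  classical
  have := Fintype.ofFinite G
  have := Fintype.ofFinite N
  by_contra! hcon
  have hp : ∀ w : W, ∑ n : N, ρ n w = 0 := by
    intro w
    by_contra h
    obtain ⟨m, hm, hne⟩ := hcon _ h
    refine hne ?_
    rw [map_sum]
    refine Fintype.sum_equiv (Equiv.mulLeft (⟨m, hm⟩ : N)) _ _ fun n => ?_
    simp [map_mul]
  obtain ⟨w, hw⟩ := exists_ne (0 : W)
  have h1 : ∑ n : N, ∑ g : G, ρ g (ρ n (ρ g⁻¹ w)) = 0 := by
    rw [Finset.sum_comm]
    refine Finset.sum_eq_zero fun g _ => ?_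
    rw [← map_sum, hp, map_zero]
  have h2 : ∀ n : N, ∑ g : G, ρ g (ρ n (ρ g⁻¹ w)) =
      (if (n : G) ∈ Subgroup.center G then (Fintype.card G : K) else 0) • w := by
    intro n
    have h3 : ∀ g : G, ρ g (ρ n (ρ g⁻¹ w)) = ((β g n : ℤˣ) : ℤ) • ρ n w := by
      intro g
      rw [hP.apply_apply_comm hρ, ← Module.End.mul_apply (ρ g), ← map_mul, mul_inv_cancel, map_one,
        Module.End.one_apply, Units.smul_def]
    rw [Finset.sum_congr rfl fun g _ => h3 g, ← Finset.sum_smul]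
    split_ifs with hn
    · have h4 : ρ n w = w := by
        have := hρ ⟨n, hn⟩ w
        rw [hP.lam_eq_one ⟨n, hn⟩ n.2, one_smul] at this
        exact this
      have h5 : ∀ g, β g n = 1 := by
        intro g
        obtain ⟨z, hz, hl⟩ := hP.commutator_eq g n
        have : z = 1 := by
          apply Subtype.ext
          rw [hz, Subgroup.mem_center_iff.1 hn g]
          simp
        rw [← hl, this, map_one]
      simp [h4, h5, Nat.cast_smul_eq_nsmul]
    · have h6 : ((Units.coeHom ℤ).comp (β.flip (n : G)) : G →* ℤ) ≠ 1 := by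
        intro h
        refine hn (hP.nondegenerate _ fun g => ?_)
        have := DFunLike.congr_fun h g
        exact Units.ext this
      have := sum_hom_units_eq_zero _ h6
      simp only [MonoidHom.comp_apply, MonoidHom.flip_apply, Units.coeHom_apply] at this
      rw [this, zero_smul, zero_smul]
  rw [Finset.sum_congr rfl fun n _ => h2 n, ← Finset.sum_smul] at h1
  rcases smul_eq_zero.1 h1 with h | h
  · rw [← Finset.sum_filter, Finset.sum_const, nsmul_eq_mul] at h
    have hc : (Finset.univ.filter fun n : N => (n : G) ∈ Subgroup.center G).card ≠ 0 :=
      Finset.card_ne_zero_of_mem (a := 1) (by simp)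
    exact mul_ne_zero (Nat.cast_ne_zero.2 hc) (Nat.cast_ne_zero.2 Fintype.card_ne_zero) h
  · exact hw h

variable {u₀ : W} (hu₀ : ∀ n ∈ N, ρ n u₀ = u₀)
  (hgen : Submodule.span K (Set.range fun g => ρ g u₀) = ⊤)

include hu₀ hgen

/-- Averaging `ρ g u₀` over `N` gives a sum of the signs `β n g`, which vanishes unless `g` is
orthogonal to `N`; such `g` are listed by `orthogonal`. -/
theorem exists_coeffs [Finite G] [CharZero K] {u : W} (hu : ∀ n ∈ N, ρ n u = u) :
    ∃ a b c d : K, u = a • u₀ + b • ρ h₀ u₀ + c • ρ g₀ u₀ + d • ρ g₀ (ρ h₀ u₀) := by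
  classical
  have := Fintype.ofFinite N
  let S : Submodule K W := Submodule.span K {u₀, ρ h₀ u₀, ρ g₀ u₀, ρ g₀ (ρ h₀ u₀)}
  have hS : ∀ {v}, v ∈ ({u₀, ρ h₀ u₀, ρ g₀ u₀, ρ g₀ (ρ h₀ u₀)} : Set W) → v ∈ S :=
    fun h => Submodule.subset_span h
  have hsgn : ∀ (e : ℤˣ) {v : W}, v ∈ S → e • v ∈ S := by
    intro e v hv
    rcases Int.units_eq_one_or e with rfl | rfl
    · simpa using hv
    · simpa using hv
  have horth : ∀ g, (∀ n ∈ N, β n g = 1) → ρ g u₀ ∈ S := by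
    intro g hg
    obtain ⟨z, n, hn, h⟩ := hP.orthogonal g hg
    have hnz : ρ n (ρ z u₀) = lam z • u₀ := by
      rw [hρ, Units.smul_def, map_zsmul, hu₀ n hn]
    rcases h with rfl | rfl | rfl | rfl
    · rw [map_mul, Module.End.mul_apply, hnz]
      exact hsgn _ (hS (by simp))
    · rw [map_mul, map_mul, Module.End.mul_apply, Module.End.mul_apply, hnz, Units.smul_def,
        map_zsmul, ← Units.smul_def]
      exact hsgn _ (hS (by simp))
    · rw [map_mul, map_mul, Module.End.mul_apply, Module.End.mul_apply, hnz, Units.smul_def,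
        map_zsmul, ← Units.smul_def]
      exact hsgn _ (hS (by simp))
    · rw [map_mul, map_mul, map_mul, Module.End.mul_apply, Module.End.mul_apply,
        Module.End.mul_apply, hnz, Units.smul_def, map_zsmul, map_zsmul, ← Units.smul_def]
      exact hsgn _ (hS (by simp))
  let p : W →ₗ[K] W := ∑ n : N, ρ n
  have hpS : ∀ v, p v ∈ S := by
    suffices h : Submodule.span K (Set.range fun g => ρ g u₀) ≤ S.comap p by
      rw [hgen] at h
      exact fun v => h trivial
    rw [Submodule.span_le]
    rintro _ ⟨g, rfl⟩
    have h1 : p (ρ g u₀) = (∑ n : N, ((β n g : ℤˣ) : ℤ)) • ρ g u₀ := by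
      rw [LinearMap.sum_apply, Finset.sum_smul]
      refine Finset.sum_congr rfl fun n _ => ?_
      rw [hP.apply_apply_comm hρ, hu₀ n n.2, Units.smul_def]
    change p (ρ g u₀) ∈ S
    rw [h1]
    by_cases hg : ∀ n ∈ N, β n g = 1
    · exact zsmul_mem (horth g hg) _
    · have h6 : ((Units.coeHom ℤ).comp ((β.flip g).comp N.subtype) : N →* ℤ) ≠ 1 := by
        intro h
        refine hg fun n hn => ?_
        have := DFunLike.congr_fun h ⟨n, hn⟩
        exact Units.ext this
      have := sum_hom_units_eq_zero _ h6
      simp only [MonoidHom.comp_apply, MonoidHom.flip_apply, Units.coeHom_apply,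
        Subgroup.subtype_apply] at this
      rw [this, zero_smul]
      exact S.zero_mem
  have hpu : p u = (Fintype.card N : K) • u := by
    rw [LinearMap.sum_apply, Finset.sum_congr rfl fun (n : N) _ => hu n n.2]
    simp [Nat.cast_smul_eq_nsmul]
  have hc : (Fintype.card N : K) ≠ 0 := Nat.cast_ne_zero.2 Fintype.card_ne_zero
  have huS : u ∈ S := by
    have := S.smul_mem (Fintype.card N : K)⁻¹ (hpu ▸ hpS u)
    rwa [smul_smul, inv_mul_cancel₀ hc, one_smul] at this
  obtain ⟨a, v, hv, rfl⟩ := Submodule.mem_span_insert.1 huS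
  obtain ⟨b, v', hv', rfl⟩ := Submodule.mem_span_insert.1 hv
  obtain ⟨c, v'', hv'', rfl⟩ := Submodule.mem_span_insert.1 hv'
  obtain ⟨d, rfl⟩ := Submodule.mem_span_singleton.1 hv''
  exact ⟨a, b, c, d, by abel⟩

end IsQuaternionicPolarization

end PolarizedCharacter

/-! ### The quaternions as endomorphisms, and irreducibility. -/

section QuaternionAction

open Representation

theorem IntertwiningMap.ext_of_span {K G W W' : Type*} [Field K] [Group G] [AddCommGroup W]
    [Module K W] [AddCommGroup W'] [Module K W'] {ρ : Representation K G W}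
    {σ : Representation K G W'} {u₀ : W}
    (hgen : Submodule.span K (Set.range fun g => ρ g u₀) = ⊤) {f f' : ρ.IntertwiningMap σ}
    (h : f u₀ = f' u₀) : f = f' := by
  apply IntertwiningMap.ext
  refine LinearMap.ext_on_range hgen fun g => ?_
  rw [IntertwiningMap.toLinearMap_apply, IntertwiningMap.toLinearMap_apply,
    IntertwiningMap.isIntertwining, IntertwiningMap.isIntertwining, h]

/-- The endomorphisms of a representation on an additive group form a ring. -/
noncomputable instance IntertwiningMap.instRing {K G W : Type*} [Field K] [Group G]
    [AddCommGroup W] [Module K W] (ρ : Representation K G W) : Ring (ρ.IntertwiningMap ρ) where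
  __ := IntertwiningMap.instSemiring ρ
  neg f := -f
  sub f f' := f - f'
  sub_eq_add_neg := sub_eq_add_neg
  zsmul n f := n • f
  zsmul_zero' := SubNegMonoid.zsmul_zero'
  zsmul_succ' := SubNegMonoid.zsmul_succ'
  zsmul_neg' := SubNegMonoid.zsmul_neg'
  neg_add_cancel := neg_add_cancel

theorem QuaternionAlgebra.star_mul_self_eq_algebraMap {K : Type*} [Field K] (q : ℍ[K, -1, -1]) :
    star q * q =
      algebraMap K ℍ[K, -1, -1] (q.re ^ 2 + q.imI ^ 2 + q.imJ ^ 2 + q.imK ^ 2) := by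
  obtain ⟨c, hc⟩ : ∃ c, c = q.re ^ 2 + q.imI ^ 2 + q.imJ ^ 2 + q.imK ^ 2 := ⟨_, rfl⟩
  rw [← hc]
  ext <;> simp <;> first | ring1 | (rw [hc]; ring1)

theorem QuaternionAlgebra.mul_star_self_eq_algebraMap {K : Type*} [Field K] (q : ℍ[K, -1, -1]) :
    q * star q =
      algebraMap K ℍ[K, -1, -1] (q.re ^ 2 + q.imI ^ 2 + q.imJ ^ 2 + q.imK ^ 2) := by
  obtain ⟨c, hc⟩ : ∃ c, c = q.re ^ 2 + q.imI ^ 2 + q.imJ ^ 2 + q.imK ^ 2 := ⟨_, rfl⟩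
  rw [← hc]
  ext <;> simp <;> first | ring1 | (rw [hc]; ring1)

/-- Multiplying the sum of four squares by `a² + b²` gives `(a² + b²)² + (ac + bd)² + (ad - bc)²`, a
sum of three squares. -/
theorem four_squares_anisotropic {K : Type*} [Field K]
    (h : ¬ ∃ t₀ t₁ t₂ : K, (t₀, t₁, t₂) ≠ (0, 0, 0) ∧ t₀ ^ 2 + t₁ ^ 2 + t₂ ^ 2 = 0)
    {a b c d : K} (habcd : a ^ 2 + b ^ 2 + c ^ 2 + d ^ 2 = 0) :
    a = 0 ∧ b = 0 ∧ c = 0 ∧ d = 0 := by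
  have h2 : ∀ x y : K, x ^ 2 + y ^ 2 = 0 → x = 0 ∧ y = 0 := by
    intro x y hxy
    by_contra hne
    refine h ⟨x, y, 0, fun h0 => hne ?_, by rw [hxy]; ring⟩
    simp only [Prod.mk.injEq] at h0
    exact ⟨h0.1, h0.2.1⟩
  by_cases hab : a ^ 2 + b ^ 2 = 0
  · obtain ⟨ha, hb⟩ := h2 a b hab
    obtain ⟨hc, hd⟩ := h2 c d (by linear_combination habcd - hab)
    exact ⟨ha, hb, hc, hd⟩
  · refine absurd ⟨a ^ 2 + b ^ 2, a * c + b * d, a * d - b * c, fun h0 => hab ?_, ?_⟩ h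
    · simp only [Prod.mk.injEq] at h0
      exact h0.1
    · linear_combination (a ^ 2 + b ^ 2) * habcd

namespace IsQuaternionicPolarization

variable {K G W : Type*} [Field K] [Group G] [AddCommGroup W] [Module K W]
  {lam : Subgroup.center G →* ℤˣ} {β : G →* G →* ℤˣ} {N : Subgroup G} {h₀ g₀ : G}
  (hP : IsQuaternionicPolarization lam β N h₀ g₀) {ρ : Representation K G W}
  (hρ : HasCentralSign ρ lam) {u₀ : W}
  (hgen : Submodule.span K (Set.range fun g => ρ g u₀) = ⊤)
  {I J : ρ.IntertwiningMap ρ} (hI : I u₀ = ρ h₀ u₀) (hJ : J u₀ = ρ g₀ u₀)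

/-- The quaternion relations between the endomorphisms which map a generator `u₀` to `ρ h₀ u₀` and
to `ρ g₀ u₀`. -/
noncomputable def quaternionBasis : QuaternionAlgebra.Basis (ρ.IntertwiningMap ρ) (-1 : K) 0 (-1) where
  i := I
  j := J
  k := I * J
  i_mul_i := by
    apply IntertwiningMap.ext_of_span hgen
    change I (I u₀) = (-1 : K) • u₀ + (0 : K) • I u₀
    rw [hI, I.isIntertwining, hI, hP.apply_h₀_h₀ hρ]
    simp
  j_mul_j := by
    apply IntertwiningMap.ext_of_span hgen
    change J (J u₀) = (-1 : K) • u₀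
    rw [hJ, J.isIntertwining, hJ, hP.apply_g₀_g₀ hρ]
    simp
  i_mul_j := rfl
  j_mul_i := by
    apply IntertwiningMap.ext_of_span hgen
    change J (I u₀) = (0 : K) • J u₀ - I (J u₀)
    rw [hI, hJ, I.isIntertwining, J.isIntertwining, hI, hJ, hP.apply_h₀_g₀ hρ]
    simp

/-- The action of the quaternions on a representation with generator `u₀`. -/
noncomputable def quaternionHom : ℍ[K, -1, -1] →ₐ[K] ρ.IntertwiningMap ρ :=
  (hP.quaternionBasis hρ hgen hI hJ).liftHom

theorem quaternionHom_apply (q : ℍ[K, -1, -1]) :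
    hP.quaternionHom hρ hgen hI hJ q u₀ =
      q.re • u₀ + q.imI • ρ h₀ u₀ + q.imJ • ρ g₀ u₀ + q.imK • ρ g₀ (ρ h₀ u₀) := by
  have h : hP.quaternionHom hρ hgen hI hJ q u₀ =
    q.re • u₀ + q.imI • I u₀ + q.imJ • J u₀ + q.imK • I (J u₀) := rfl
  -- Endomorphisms compose in the order opposite to the group elements: `I (J u₀) = I (ρ g₀ u₀) = ρ
  -- g₀ (ρ h₀ u₀)`.
  rw [h, hJ, I.isIntertwining, hI]

theorem quaternionHom_star_apply (q : ℍ[K, -1, -1]) (w : W) :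
    hP.quaternionHom hρ hgen hI hJ (star q) (hP.quaternionHom hρ hgen hI hJ q w) =
      (q.re ^ 2 + q.imI ^ 2 + q.imJ ^ 2 + q.imK ^ 2) • w := by
  have := congrArg (fun T => T w) (congrArg (hP.quaternionHom hρ hgen hI hJ)
    (QuaternionAlgebra.star_mul_self_eq_algebraMap q))
  rw [map_mul, AlgHom.commutes] at this
  exact this

theorem quaternionHom_apply_star (q : ℍ[K, -1, -1]) (w : W) :
    hP.quaternionHom hρ hgen hI hJ q (hP.quaternionHom hρ hgen hI hJ (star q) w) =
      (q.re ^ 2 + q.imI ^ 2 + q.imJ ^ 2 + q.imK ^ 2) • w := by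
  have := congrArg (fun T => T w) (congrArg (hP.quaternionHom hρ hgen hI hJ)
    (QuaternionAlgebra.mul_star_self_eq_algebraMap q))
  rw [map_mul, AlgHom.commutes] at this
  exact this

theorem exists_quaternionHom_apply_eq [Finite G] [CharZero K] (hu₀ : ∀ n ∈ N, ρ n u₀ = u₀) {u : W}
    (hu : ∀ n ∈ N, ρ n u = u) : ∃ q, hP.quaternionHom hρ hgen hI hJ q u₀ = u := by
  obtain ⟨a, b, c, d, rfl⟩ := hP.exists_coeffs hρ hu₀ hgen hu
  exact ⟨⟨a, b, c, d⟩, hP.quaternionHom_apply hρ hgen hI hJ _⟩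

/-- Injective because the norm is anisotropic; surjective because an endomorphism sends `u₀` to an
`N`-fixed vector, and these are the `q u₀`. -/
theorem quaternionHom_bijective [Finite G] [CharZero K] [Nontrivial W]
    (hu₀ : ∀ n ∈ N, ρ n u₀ = u₀)
    (hK : ¬ ∃ t₀ t₁ t₂ : K, (t₀, t₁, t₂) ≠ (0, 0, 0) ∧ t₀ ^ 2 + t₁ ^ 2 + t₂ ^ 2 = 0) :
    Function.Bijective (hP.quaternionHom hρ hgen hI hJ) := by
  constructor
  · rw [injective_iff_map_eq_zero]
    intro q hq
    obtain ⟨w, hw⟩ := exists_ne (0 : W)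
    have h := hP.quaternionHom_star_apply hρ hgen hI hJ q w
    rw [hq, IntertwiningMap.coe_zero, Pi.zero_apply, map_zero] at h
    obtain ⟨h1, h2, h3, h4⟩ := four_squares_anisotropic hK
      ((smul_eq_zero.1 h.symm).resolve_right hw)
    exact QuaternionAlgebra.ext h1 h2 h3 h4
  · intro f
    obtain ⟨q, hq⟩ := hP.exists_quaternionHom_apply_eq hρ hgen hI hJ hu₀ (u := f u₀)
      fun n hn => by rw [← f.isIntertwining, hu₀ n hn]
    exact ⟨q, IntertwiningMap.ext_of_span hgen hq⟩

include hP hρ hgen hI hJ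

/-- A nonzero subrepresentation contains a nonzero `N`-fixed vector `q u₀`, hence the image of `q`;
as `q` has nonzero norm it is invertible, and its image is everything. -/
theorem isIrreducible [Finite G] [CharZero K] [Nontrivial W]
    (hu₀ : ∀ n ∈ N, ρ n u₀ = u₀)
    (hK : ¬ ∃ t₀ t₁ t₂ : K, (t₀, t₁, t₂) ≠ (0, 0, 0) ∧ t₀ ^ 2 + t₁ ^ 2 + t₂ ^ 2 = 0) :
    ρ.IsIrreducible := by
  have hnt : Nontrivial (Subrepresentation ρ) := by
    refine ⟨⊥, ⊤, fun h => ?_⟩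
    obtain ⟨w, hw⟩ := exists_ne (0 : W)
    have h1 : (⊤ : Submodule K W) = ⊥ := (congrArg Subrepresentation.toSubmodule h).symm
    exact hw ((Submodule.mem_bot K).1 (h1 ▸ Submodule.mem_top (x := w)))
  refine ⟨fun S => ?_⟩
  by_cases hS : S.toSubmodule = ⊥
  · exact Or.inl (Subrepresentation.toSubmodule_injective hS)
  right
  have : Nontrivial S.toSubmodule := (Submodule.nontrivial_iff_ne_bot).2 hS
  have hρS : HasCentralSign S.toRepresentation lam := by
    intro z w
    apply Subtype.ext
    have h1 : (((S.toRepresentation z) w : S.toSubmodule) : W) = ρ z w := rfl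
    rw [h1, hρ, Units.smul_def, Units.smul_def]
    rfl
  obtain ⟨⟨u, huS⟩, hu0, hu⟩ := hP.exists_fixed hρS
  obtain ⟨q, hq⟩ := hP.exists_quaternionHom_apply_eq hρ hgen hI hJ hu₀ (u := u)
    fun n hn => congrArg Subtype.val (hu n hn)
  have hmem : ∀ w, hP.quaternionHom hρ hgen hI hJ q w ∈ S.toSubmodule := by
    suffices h : Submodule.span K (Set.range fun g => ρ g u₀) ≤
        S.toSubmodule.comap (hP.quaternionHom hρ hgen hI hJ q).toLinearMap by
      rw [hgen] at h
      exact fun w => h trivial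
    rw [Submodule.span_le]
    rintro _ ⟨g, rfl⟩
    change hP.quaternionHom hρ hgen hI hJ q (ρ g u₀) ∈ S.toSubmodule
    rw [IntertwiningMap.isIntertwining, hq]
    exact S.apply_mem_toSubmodule g huS
  have hnorm : q.re ^ 2 + q.imI ^ 2 + q.imJ ^ 2 + q.imK ^ 2 ≠ 0 := by
    intro h
    obtain ⟨h1, h2, h3, h4⟩ := four_squares_anisotropic hK h
    have : q = 0 := QuaternionAlgebra.ext h1 h2 h3 h4
    rw [this, map_zero] at hq
    exact hu0 (Subtype.ext hq.symm)
  apply Subrepresentation.toSubmodule_injective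
  change S.toSubmodule = ⊤
  rw [eq_top_iff]
  intro w _
  have h1 := hmem (hP.quaternionHom hρ hgen hI hJ (star q) w)
  rw [hP.quaternionHom_apply_star] at h1
  have h2 := S.toSubmodule.smul_mem (q.re ^ 2 + q.imI ^ 2 + q.imJ ^ 2 + q.imK ^ 2)⁻¹ h1
  rwa [smul_smul, inv_mul_cancel₀ hnorm, one_smul] at h2

/-- The pure quaternion `q` with coordinates `t₀, t₁, t₂` satisfies `star q = -q` and has norm zero,
so it acts with square zero. By Schur's lemma it must act as zero, which is excluded. -/
theorem not_isIrreducible [CharZero K] [Nontrivial W]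
    (hK : ∃ t₀ t₁ t₂ : K, (t₀, t₁, t₂) ≠ (0, 0, 0) ∧ t₀ ^ 2 + t₁ ^ 2 + t₂ ^ 2 = 0) :
    ¬ ρ.IsIrreducible := by
  intro hirr
  obtain ⟨t₀, t₁, t₂, hne, ht⟩ := hK
  obtain ⟨w, hw⟩ := exists_ne (0 : W)
  let Θ := hP.quaternionHom hρ hgen hI hJ
  let q : ℍ[K, -1, -1] := ⟨0, t₀, t₁, t₂⟩
  have hsq : ∀ v, Θ (star q) (Θ q v) = 0 := by
    intro v
    rw [hP.quaternionHom_star_apply]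
    have : q.re ^ 2 + q.imI ^ 2 + q.imJ ^ 2 + q.imK ^ 2 = 0 := by
      simpa [q] using ht
    rw [this, zero_smul]
  have hstar : Θ (star q) = -Θ q := by
    rw [← map_neg]
    congr 1
    ext <;> simp [q]
  have hsc : ∀ c : K, Θ (algebraMap K _ c) = 0 → c = 0 := by
    intro c hc
    rw [AlgHom.commutes] at hc
    have : c • w = 0 := congrArg (fun T => T w) hc
    exact (smul_eq_zero.1 this).resolve_right hw
  -- Injectivity of `Θ` is not at hand for an isotropic norm. Instead, the anticommutators of `q`
  -- with `i, j, k` are the scalars `-2t₀, -2t₁, -2t₂`, and `Θ` is injective on scalars.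
  have hzero : Θ q = 0 → False := by
    intro h
    have hanti : ∀ r, Θ (r * q + q * r) = 0 := fun r => by
      rw [map_add, map_mul, map_mul, h, mul_zero, zero_mul, add_zero]
    have hscal : ∀ {r : ℍ[K, -1, -1]} {t c : K}, c = -2 * t → r * q + q * r = algebraMap K _ c →
        t = 0 := fun hc hr => by
      have := hsc _ (hr ▸ hanti _)
      rw [hc] at this
      simpa using this
    have h0 : t₀ = 0 := by
      obtain ⟨c, hc⟩ : ∃ c, c = -2 * t₀ := ⟨_, rfl⟩
      refine hscal (r := ⟨0, 1, 0, 0⟩) hc ?_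
      ext <;> simp [q]
      rw [hc]
      ring
    have h1 : t₁ = 0 := by
      obtain ⟨c, hc⟩ : ∃ c, c = -2 * t₁ := ⟨_, rfl⟩
      refine hscal (r := ⟨0, 0, 1, 0⟩) hc ?_
      ext <;> simp [q]
      rw [hc]
      ring
    have h2 : t₂ = 0 := by
      obtain ⟨c, hc⟩ : ∃ c, c = -2 * t₂ := ⟨_, rfl⟩
      refine hscal (r := ⟨0, 0, 0, 1⟩) hc ?_
      ext <;> simp [q]
      rw [hc]
      ring
    exact hne (by rw [h0, h1, h2])
  rcases IsIrreducible.injective_or_eq_zero (Θ q) with h | h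
  · have h1 : Θ q w = 0 := by
      apply h
      have := hsq w
      rw [hstar, IntertwiningMap.coe_neg, Pi.neg_apply, neg_eq_zero] at this
      rw [this, map_zero]
    exact hw (h (h1.trans (map_zero _).symm))
  · exact hzero h

end IsQuaternionicPolarization

end QuaternionAction

/-! ### Induced representations as coinvariants. -/

section InducedRepresentation

open Representation

variable {k G A W : Type*} [Field k] [Group G] {H : Subgroup G} [AddCommGroup A] [Module k A]
  [AddCommGroup W] [Module k W] (τ : Representation k H A)

theorem indV_mk_apply (h : H) (g : G) (a : A) :
    IndV.mk H.subtype τ g (τ h a) = IndV.mk H.subtype τ ((h : G)⁻¹ * g) a := by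
  have := Coinvariants.mk_inv_tmul ((leftRegular k G).comp H.subtype) τ
    (MonoidAlgebra.single g (1 : k)) a h
  simpa using this.symm

theorem ind_apply_mk (g g' : G) (a : A) :
    τ.ind H.subtype g (IndV.mk H.subtype τ g' a) = IndV.mk H.subtype τ (g' * g⁻¹) a :=
  ind_mk H.subtype τ g g' a

/-- The component at the trivial coset embeds into the induced representation. -/
theorem indV_mk_one_injective : Function.Injective (IndV.mk H.subtype τ 1) := by
  classical
  -- A retraction supported on `H`: `mk g a` goes to `τ g⁻¹ a` for `g ∈ H` and to zero otherwise.
  let c : G → A →ₗ[k] A := fun g => if hg : g ∈ H then τ (⟨g, hg⟩ : H)⁻¹ else 0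
  have hc : ∀ (h : H) (g : G) (a : A), c (h * g) (τ h a) = c g a := by
    intro h g a
    by_cases hg : g ∈ H
    · have hhg : (h : G) * g ∈ H := H.mul_mem h.2 hg
      simp only [c, hg, hhg, dif_pos]
      rw [← Module.End.mul_apply, ← map_mul]
      congr 2
      apply Subtype.ext
      simp
    · have hhg : (h : G) * g ∉ H := fun h' => hg ((H.mul_mem_cancel_left h.2).1 h')
      simp [c, hg, hhg]
  let F : IndV H.subtype τ →ₗ[k] A := Coinvariants.lift _
    (TensorProduct.lift ((Finsupp.lift _ _ _ c) ∘ₗ (MonoidAlgebra.coeffLinearEquiv k).toLinearMap))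
    fun h => by
      ext g a
      simpa using hc h g a
  have hF : ∀ a, F (IndV.mk H.subtype τ 1 a) = a := by
    intro a
    have : F (IndV.mk H.subtype τ 1 a) = c 1 a := by simp [F]
    rw [this]
    have h1 : (⟨1, H.one_mem⟩ : H)⁻¹ = 1 := by simp
    simp [c, H.one_mem, h1]
  exact Function.LeftInverse.injective hF

/-- Frobenius reciprocity. -/
theorem exists_intertwiningMap_ind (ρ : Representation k G W) (f : A →ₗ[k] W)
    (hf : ∀ (h : H) (a : A), f (τ h a) = ρ h (f a)) :
    ∃ F : (τ.ind H.subtype).IntertwiningMap ρ, ∀ a, F (IndV.mk H.subtype τ 1 a) = f a := by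
  -- `mk g a` goes to `ρ g⁻¹ (f a)`, because `G` acts on the index by right multiplication with
  -- inverses.
  let F : IndV H.subtype τ →ₗ[k] W := Coinvariants.lift _
    (TensorProduct.lift ((Finsupp.lift _ _ _ fun g : G => ρ g⁻¹ ∘ₗ f) ∘ₗ
      (MonoidAlgebra.coeffLinearEquiv k).toLinearMap))
    fun h => by
      ext g a
      simp [hf]
  exact ⟨⟨F, fun g => by ext; simp [F]⟩, fun a => by simp [F]⟩

end InducedRepresentation

/-! ### The rational basis `1, i` of `ℚ(i)`. -/

section GaussianField

/-- The imaginary unit of `ℚ(i)`. -/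
noncomputable def gaussianI : GaussianField := IntermediateField.AdjoinSimple.gen ℚ Complex.I

theorem gaussianI_mul_self : gaussianI * gaussianI = -1 := by
  apply Subtype.ext
  simp [gaussianI]

theorem gaussianField_exists_eq (z : GaussianField) : ∃ a b : ℚ, z = a • 1 + b • gaussianI := by
  have hint : IsIntegral ℚ Complex.I := ⟨Polynomial.X ^ 2 + 1, by monicity!, by simp⟩
  have key : ∀ x ∈ Algebra.adjoin ℚ {Complex.I}, ∃ a b : ℚ, x = a + b * Complex.I := by
    intro x hx
    induction hx using Algebra.adjoin_induction with
    | mem x hx => exact ⟨0, 1, by simpa using hx⟩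
    | algebraMap r => exact ⟨r, 0, by simp⟩
    | add x y _ _ hx hy =>
      obtain ⟨a, b, rfl⟩ := hx
      obtain ⟨c, d, rfl⟩ := hy
      exact ⟨a + c, b + d, by push_cast; ring⟩
    | mul x y _ _ hx hy =>
      obtain ⟨a, b, rfl⟩ := hx
      obtain ⟨c, d, rfl⟩ := hy
      refine ⟨a * c - b * d, a * d + b * c, ?_⟩
      push_cast
      linear_combination (b * d : ℂ) * Complex.I_mul_I
  obtain ⟨a, b, h⟩ := key z <| by
    rw [← IntermediateField.adjoin_simple_toSubalgebra_of_isAlgebraic hint.isAlgebraic]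
    exact z.2
  refine ⟨a, b, Subtype.ext ?_⟩
  rw [h]
  simp [gaussianI, Algebra.smul_def]

theorem gaussianField_linearMap_ext {W : Type*} [AddCommGroup W] [Module ℚ W]
    {f f' : GaussianField →ₗ[ℚ] W} (h1 : f 1 = f' 1) (hI : f gaussianI = f' gaussianI) :
    f = f' := by
  ext z
  obtain ⟨a, b, rfl⟩ := gaussianField_exists_eq z
  simp only [map_add, map_smul, h1, hI]

theorem gaussianField_exists_linearMap {W : Type*} [AddCommGroup W] [Module ℚ W] (w w' : W) :
    ∃ f : GaussianField →ₗ[ℚ] W, f 1 = w ∧ f gaussianI = w' := by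
  have hli : LinearIndependent ℚ ![(1 : GaussianField), gaussianI] := by
    rw [LinearIndependent.pair_iff]
    intro a b h
    have h' : (a : ℂ) + b * Complex.I = 0 := by
      have := congrArg Subtype.val h
      simpa [gaussianI, Algebra.smul_def] using this
    have hre := congrArg Complex.re h'
    have him := congrArg Complex.im h'
    simp at hre him
    exact ⟨hre, him⟩
  have hsp : ⊤ ≤ Submodule.span ℚ (Set.range ![(1 : GaussianField), gaussianI]) := by
    intro z _
    obtain ⟨a, b, rfl⟩ := gaussianField_exists_eq z
    refine add_mem (Submodule.smul_mem _ _ (Submodule.subset_span ⟨0, rfl⟩))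
      (Submodule.smul_mem _ _ (Submodule.subset_span ⟨1, rfl⟩))
  let b := Module.Basis.mk hli hsp
  refine ⟨b.constr ℚ ![w, w'], ?_, ?_⟩
  · have := b.constr_basis ℚ ![w, w'] 0
    simpa [b] using this
  · have := b.constr_basis ℚ ![w, w'] 1
    simpa [b] using this

end GaussianField

/-! ### Generator, central character and universal property of `2V_x`. -/

section RepTwoV

open Representation

/-- The compatibility of a homomorphism `χ : H → ℚ(i)ˣ` with a sign character `lam` of the center,
the kernel `N` of `χ` and an element `h₀` with `χ h₀ = i`. -/
structure IsPolarizingCharacter {G : Type*} [Group G] (lam : Subgroup.center G →* ℤˣ)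
    (N : Subgroup G) (h₀ : G) {H : Subgroup G} (χ : H →* GaussianFieldˣ) : Prop where
  center : ∀ z : Subgroup.center G, ∃ h : H, (h : G) = z ∧ (χ h : GaussianField) = (lam z : ℤ)
  ker : ∀ n ∈ N, ∃ h : H, (h : G) = n ∧ χ h = 1
  gen : ∃ h : H, (h : G) = h₀ ∧ (χ h : GaussianField) = gaussianI
  comm : ∀ h ∈ H, h * h₀ = h₀ * h
  cover : ∀ h : H, ∃ z : Subgroup.center G, ∃ n ∈ N, (h : G) = n * z ∨ (h : G) = h₀ * n * z

variable {G : Type u} [Group G] {lam : Subgroup.center G →* ℤˣ} {β : G →* G →* ℤˣ}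
  {N : Subgroup G} {h₀ g₀ : G} {H : Subgroup G} {χ : H →* GaussianFieldˣ}

/-- The representation `2V`, before it is bundled. -/
noncomputable abbrev indCharRep (χ : H →* GaussianFieldˣ) :
    Representation ℚ G (IndV H.subtype (charRep ℚ χ)) :=
  (charRep ℚ χ).ind H.subtype

/-- The canonical generator of the representation `2V`. -/
noncomputable def indCharRepGen (χ : H →* GaussianFieldˣ) : IndV H.subtype (charRep ℚ χ) :=
  IndV.mk H.subtype (charRep ℚ χ) 1 1

theorem charRep_apply (h : H) (a : GaussianField) : charRep ℚ χ h a = (χ h : GaussianField) * a :=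
  rfl

theorem indCharRepGen_ne_zero : indCharRepGen χ ≠ 0 := by
  intro h
  exact one_ne_zero (indV_mk_one_injective (charRep ℚ χ) (h.trans (map_zero _).symm))

theorem indCharRep_apply_gen (h : H) :
    indCharRep χ h (indCharRepGen χ) = IndV.mk H.subtype (charRep ℚ χ) 1 (χ h) := by
  have h1 := ind_apply_mk (charRep ℚ χ) h 1 (1 : GaussianField)
  have h2 := indV_mk_apply (charRep ℚ χ) h 1 (1 : GaussianField)
  rw [charRep_apply, mul_one, mul_one] at h2
  rw [one_mul] at h1
  exact h1.trans h2.symm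

theorem indCharRep_apply_mk (g g' : G) (a : GaussianField) :
    indCharRep χ g (IndV.mk H.subtype (charRep ℚ χ) g' a) =
      IndV.mk H.subtype (charRep ℚ χ) (g' * g⁻¹) a :=
  ind_apply_mk (charRep ℚ χ) g g' a

namespace IsPolarizingCharacter

variable (hχ : IsPolarizingCharacter lam N h₀ χ)

include hχ

theorem indCharRep_fixed : ∀ n ∈ N, indCharRep χ n (indCharRepGen χ) = indCharRepGen χ := by
  intro n hn
  obtain ⟨h, rfl, hh⟩ := hχ.ker n hn
  rw [indCharRep_apply_gen, hh]
  rfl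

theorem indCharRep_span :
    Submodule.span ℚ (Set.range fun g => indCharRep χ g (indCharRepGen χ)) = ⊤ := by
  obtain ⟨h, -, hI⟩ := hχ.gen
  rw [eq_top_iff]
  set S := Submodule.span ℚ (Set.range fun g => indCharRep χ g (indCharRepGen χ)) with hS
  have hmem : ∀ g, indCharRep χ g (indCharRepGen χ) ∈ S := fun g => Submodule.subset_span ⟨g, rfl⟩
  have h1 : ∀ g : G, IndV.mk H.subtype (charRep ℚ χ) g 1 ∈ S := by
    intro g
    have h2 := hmem g⁻¹
    rw [indCharRepGen, indCharRep_apply_mk] at h2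
    simpa using h2
  have h2 : ∀ g : G, IndV.mk H.subtype (charRep ℚ χ) g gaussianI ∈ S := by
    intro g
    have h3 := indV_mk_apply (charRep ℚ χ) h g (1 : GaussianField)
    rw [charRep_apply, mul_one, hI] at h3
    rw [h3]
    exact h1 _
  have h3 : S.mkQ = 0 := by
    apply IndV.hom_ext
    intro g
    apply gaussianField_linearMap_ext
    · exact (Submodule.Quotient.mk_eq_zero S).2 (h1 g)
    · exact (Submodule.Quotient.mk_eq_zero S).2 (h2 g)
  intro v _
  exact (Submodule.Quotient.mk_eq_zero S).1 (LinearMap.congr_fun h3 v)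

theorem indCharRep_hasCentralSign : HasCentralSign (indCharRep χ) lam := by
  intro z
  obtain ⟨h, hz, hh⟩ := hχ.center z
  suffices H1 : indCharRep χ z = ((lam z : ℤ) : ℚ) • LinearMap.id by
    intro w
    rw [H1, LinearMap.smul_apply, LinearMap.id_apply, Units.smul_def, Int.cast_smul_eq_zsmul]
  refine LinearMap.ext_on_range hχ.indCharRep_span fun g => ?_
  rw [← Module.End.mul_apply, ← map_mul, ← Subgroup.mem_center_iff.1 z.2 g, map_mul,
    Module.End.mul_apply, ← hz, indCharRep_apply_gen, hh]
  have : ((lam z : ℤ) : GaussianField) = ((lam z : ℤ) : ℚ) • 1 := by simp [Algebra.smul_def]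
  rw [this, map_smul, map_smul]
  rfl

/-- Frobenius reciprocity for the map `1 ↦ w`, `i ↦ σ h₀ w`. It is `H`-equivariant since each
element of `H` is `n z` or `h₀ n z`, and `σ h₀` squares to `-1` just as `i` does. -/
theorem exists_intertwiningMap (hP : IsQuaternionicPolarization lam β N h₀ g₀) {W : Type*}
    [AddCommGroup W] [Module ℚ W] {σ : Representation ℚ G W} (hσ : HasCentralSign σ lam) {w : W}
    (hw : ∀ n ∈ N, σ n w = w) :
    ∃ F : (indCharRep χ).IntertwiningMap σ, F (indCharRepGen χ) = w := by
  obtain ⟨f, hf1, hfI⟩ := gaussianField_exists_linearMap w (σ h₀ w)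
  obtain ⟨h₁, hh₁, hI⟩ := hχ.gen
  have hcoe : ∀ h h' : H, (h : G) = h' → (χ h : GaussianField) = χ h' := fun h h' e => by
    rw [Subtype.ext e]
  have hsmul : ∀ (z : Subgroup.center G) (a : GaussianField),
      f ((lam z : ℤ) * a) = lam z • f a := fun z a => by
    rw [← zsmul_eq_mul, map_zsmul, Units.smul_def]
  have hcomm : ∀ h ∈ H, σ h (σ h₀ w) = σ h₀ (σ h w) := fun h hh => by
    rw [← Module.End.mul_apply, ← map_mul, hχ.comm h hh, map_mul, Module.End.mul_apply]
  have hval : ∀ h : H, ∃ z : Subgroup.center G, (((χ h : GaussianField) = (lam z : ℤ) * 1) ∧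
      σ h w = lam z • w) ∨
      (((χ h : GaussianField) = (lam z : ℤ) * gaussianI) ∧ σ h w = lam z • σ h₀ w) := by
    intro h
    obtain ⟨z, n, hn, hh⟩ := hχ.cover h
    obtain ⟨hz, hz1, hz2⟩ := hχ.center z
    obtain ⟨n', hn1, hn2⟩ := hχ.ker n hn
    refine ⟨z, hh.imp (fun hh => ⟨?_, ?_⟩) fun hh => ⟨?_, ?_⟩⟩
    · rw [hcoe h (n' * hz) (by rw [hh, Subgroup.coe_mul, hn1, hz1]), map_mul, hn2, one_mul, hz2,
        mul_one]
    · rw [hh, map_mul, Module.End.mul_apply, hσ, Units.smul_def, map_zsmul, hw n hn]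
    · rw [hcoe h (h₁ * n' * hz) (by rw [hh, Subgroup.coe_mul, Subgroup.coe_mul, hn1, hz1, hh₁]),
        map_mul, map_mul, hn2, mul_one, Units.val_mul, hz2, hI, mul_comm]
    · rw [hh, map_mul, map_mul, Module.End.mul_apply, Module.End.mul_apply, hσ, Units.smul_def,
        Units.smul_def, map_zsmul, map_zsmul, hw n hn]
  obtain ⟨F, hF⟩ := exists_intertwiningMap_ind (charRep ℚ χ) σ f <| by
    intro h
    have : f ∘ₗ charRep ℚ χ h = σ h ∘ₗ f := by
      obtain ⟨z, ⟨hz, hw'⟩ | ⟨hz, hw'⟩⟩ := hval h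
      · apply gaussianField_linearMap_ext
        · rw [LinearMap.comp_apply, LinearMap.comp_apply, charRep_apply, hz, mul_one, hsmul, hf1, hw']
        · rw [LinearMap.comp_apply, LinearMap.comp_apply, charRep_apply, hz, mul_one, hsmul, hfI,
            hcomm h h.2, hw', Units.smul_def, Units.smul_def, map_zsmul]
      · apply gaussianField_linearMap_ext
        · rw [LinearMap.comp_apply, LinearMap.comp_apply, charRep_apply, hz, mul_one, hsmul, hfI, hf1,
            hw']
        · rw [LinearMap.comp_apply, LinearMap.comp_apply, charRep_apply, hz, mul_assoc,
            gaussianI_mul_self, hsmul, map_neg, hf1, hfI, hcomm h h.2, hw', Units.smul_def,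
            Units.smul_def, map_zsmul, hP.apply_h₀_h₀ hσ]
    exact LinearMap.congr_fun this
  exact ⟨F, (hF 1).trans hf1⟩

end IsPolarizingCharacter

end RepTwoV

/-! ### Extension of scalars from `ℚ` to `K`. -/

section ExtendScalars

open Representation

variable {G V : Type*} [Group G] (K : Type*) [Field K] [Algebra ℚ K] [AddCommGroup V] [Module ℚ V]
  (ρ : Representation ℚ G V)

/-- The extension of scalars of a representation, before it is bundled. -/
noncomputable def baseChangeRep : Representation K G (K ⊗[ℚ] V) where
  toFun g := (ρ g).baseChange K
  map_one' := by ext; simp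
  map_mul' g h := by ext; simp

theorem baseChangeRep_apply_tmul (g : G) (c : K) (v : V) :
    baseChangeRep K ρ g (c ⊗ₜ[ℚ] v) = c ⊗ₜ[ℚ] ρ g v :=
  LinearMap.baseChange_tmul _ _ _

variable {ρ}

theorem baseChangeRep_span {u₀ : V} (h : Submodule.span ℚ (Set.range fun g => ρ g u₀) = ⊤) :
    Submodule.span K (Set.range fun g => baseChangeRep K ρ g (1 ⊗ₜ[ℚ] u₀)) = ⊤ := by
  have h1 := Submodule.baseChange_span (R := ℚ) (M := V) K (Set.range fun g => ρ g u₀)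
  rw [h, Submodule.baseChange_top, ← Set.range_comp] at h1
  exact h1.symm

theorem baseChangeRep_hasCentralSign {lam : Subgroup.center G →* ℤˣ}
    (h : HasCentralSign ρ lam) : HasCentralSign (baseChangeRep K ρ) lam := by
  intro z w
  have : baseChangeRep K ρ z = ((lam z : ℤ) : K) • LinearMap.id := by
    refine TensorProduct.AlgebraTensorModule.ext fun c (v : V) => ?_
    rw [baseChangeRep_apply_tmul, h, Units.smul_def, LinearMap.smul_apply, LinearMap.id_apply,
      Int.cast_smul_eq_zsmul, ← TensorProduct.mk_apply, map_zsmul, TensorProduct.mk_apply]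
  rw [this, LinearMap.smul_apply, LinearMap.id_apply, Units.smul_def, Int.cast_smul_eq_zsmul]

/-- Restriction of scalars is right adjoint to base change. The rational structure on `W` is only
chosen in the proof, so `h` is stated for all of them. -/
theorem baseChangeRep_exists_intertwiningMap {u₀ : V} {W : Type*} [AddCommGroup W] [Module K W]
    (σ : Representation K G W) {w : W}
    (h : ∀ [Module ℚ W] (τ : Representation ℚ G W), (∀ g v, τ g v = σ g v) →
      ∃ F : ρ.IntertwiningMap τ, F u₀ = w) :
    ∃ F : (baseChangeRep K ρ).IntertwiningMap σ, F (1 ⊗ₜ[ℚ] u₀) = w := by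
  let _ : Module ℚ W := Module.compHom W (algebraMap ℚ K)
  have : IsScalarTower ℚ K W := IsScalarTower.of_compHom ℚ K W
  let τ : Representation ℚ G W :=
    { toFun := fun g => (σ g).restrictScalars ℚ
      map_one' := by ext; simp
      map_mul' := fun _ _ => by ext; simp }
  obtain ⟨F, hF⟩ := h τ fun _ _ => rfl
  refine ⟨⟨F.toLinearMap.liftBaseChange K, fun g => ?_⟩, ?_⟩
  · refine TensorProduct.AlgebraTensorModule.ext fun c v => ?_
    rw [LinearMap.comp_apply, LinearMap.comp_apply, baseChangeRep_apply_tmul,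
      LinearMap.liftBaseChange_tmul, LinearMap.liftBaseChange_tmul, map_smul,
      IntertwiningMap.toLinearMap_apply, IntertwiningMap.toLinearMap_apply,
      IntertwiningMap.isIntertwining]
    rfl
  · change F.toLinearMap.liftBaseChange K (1 ⊗ₜ[ℚ] u₀) = w
    rw [LinearMap.liftBaseChange_tmul, one_smul]
    exact hF

end ExtendScalars

/-! ### The squaring map of a special 2-group and the choice of `h₀`, `g₀`. -/

section Polarization

/-- The sign homomorphism whose kernel is a given subgroup of index two. -/
noncomputable def indexTwoSign {A : Type*} [Group A] (x : Subgroup A) (hx : x.index = 2) :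
    A →* ℤˣ := by
  classical
  exact
    { toFun := fun a => if a ∈ x then 1 else -1
      map_one' := if_pos x.one_mem
      map_mul' := fun a b => by
        have := Subgroup.mul_mem_iff_of_index_two hx (a := a) (b := b)
        by_cases ha : a ∈ x <;> by_cases hb : b ∈ x <;> simp [ha, hb, this] }

theorem indexTwoSign_eq_one_iff {A : Type*} [Group A] {x : Subgroup A} (hx : x.index = 2) {a : A} :
    indexTwoSign x hx a = 1 ↔ a ∈ x := by
  classical
  change (if a ∈ x then (1 : ℤˣ) else -1) = 1 ↔ a ∈ x
  split_ifs with h <;> simp [h]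

theorem exists_addMonoidHom_of_sign {A : Type*} [CommGroup A] (lam : A →* ℤˣ) :
    ∃ f : Additive A →+ ZMod 2, ∀ a b : A,
      f (Additive.ofMul a) = f (Additive.ofMul b) ↔ lam a = lam b := by
  classical
  let f : Additive A →+ ZMod 2 :=
    { toFun := fun a => if lam a.toMul = 1 then 0 else 1
      map_zero' := by simp
      map_add' := fun a b => by
        rw [toMul_add, map_mul]
        rcases Int.units_eq_one_or (lam a.toMul) with ha | ha <;>
          rcases Int.units_eq_one_or (lam b.toMul) with hb | hb <;> simp [ha, hb]
        decide }
  refine ⟨f, fun a b => ?_⟩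
  change (if lam a = 1 then (0 : ZMod 2) else 1) = (if lam b = 1 then (0 : ZMod 2) else 1) ↔ _
  rcases Int.units_eq_one_or (lam a) with ha | ha <;>
    rcases Int.units_eq_one_or (lam b) with hb | hb <;> simp [ha, hb]

variable {F : Type*} [Field F] {G : Type*} [Group G]

theorem IsSpecialPGroup.of_eq_one_iff {p : ℕ} (hG : IsSpecialPGroup p G) (g : G) :
    Abelianization.of g = 1 ↔ g ∈ Subgroup.center G := by
  rw [← hG.commutator_eq]
  exact QuotientGroup.eq_one_iff g

theorem IsSpecialPGroup.mul_self_mem_center {p : ℕ} [CharP F 2] (hG : IsSpecialPGroup p G)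
    [Module F (Additive (Abelianization G))] (g : G) : g * g ∈ Subgroup.center G := by
  rw [← hG.of_eq_one_iff, map_mul]
  exact add_self_of_charP_two (F := F) (Additive.ofMul (Abelianization.of g))

theorem center_mul_self [CharP F 2] [Module F (Additive (Subgroup.center G))]
    (z : Subgroup.center G) : z * z = 1 :=
  add_self_of_charP_two (F := F) (Additive.ofMul z)

/-- Squaring descends to `Gᵃᵇ` because `(g z)² = g² z² = g²` for central `z`. -/
theorem IsSpecialPGroup.exists_square_map {p : ℕ} [CharP F 2] (hG : IsSpecialPGroup p G)
    [Module F (Additive (Subgroup.center G))] [Module F (Additive (Abelianization G))] :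
    ∃ Q : Additive (Abelianization G) → Additive (Subgroup.center G),
      ∀ g : G, ((Q (Additive.ofMul (Abelianization.of g))).toMul : G) = g * g := by
  have hsurj : Function.Surjective (Abelianization.of : G →* Abelianization G) :=
    QuotientGroup.mk_surjective
  choose r hr using hsurj
  refine ⟨fun a => Additive.ofMul ⟨r a.toMul * r a.toMul, hG.mul_self_mem_center (F := F) _⟩,
    fun g => ?_⟩
  change r (Abelianization.of g) * r (Abelianization.of g) = g * g
  set s := r (Abelianization.of g)
  have hz : g⁻¹ * s ∈ Subgroup.center G := by
    rw [← hG.of_eq_one_iff, map_mul, map_inv, hr, inv_mul_cancel]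
  have h1 : (g⁻¹ * s) * (g⁻¹ * s) = 1 :=
    congrArg Subtype.val (center_mul_self (F := F) (⟨_, hz⟩ : Subgroup.center G))
  have h2 := Subgroup.mem_center_iff.1 hz g
  calc s * s = g * (g⁻¹ * s) * (g * (g⁻¹ * s)) := by group
    _ = g * ((g⁻¹ * s) * g) * (g⁻¹ * s) := by group
    _ = g * g * ((g⁻¹ * s) * (g⁻¹ * s)) := by rw [← h2]; group
    _ = g * g := by rw [h1, mul_one]

variable [Module F (Additive (Subgroup.center G))] [Module F (Additive (Abelianization G))]
  {B : Additive (Abelianization G) →ₗ[F] Additive (Abelianization G) →ₗ[F]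
    Additive (Subgroup.center G)}
  (hB : ∀ a b : G,
    ((B (Additive.ofMul (Abelianization.of a)) (Additive.ofMul (Abelianization.of b))).toMul : G)
      = a * b * a⁻¹ * b⁻¹)

include hB

theorem commutatorPairing_isAlt : B.IsAlt := by
  intro a
  obtain ⟨g, hg⟩ := QuotientGroup.mk_surjective a.toMul
  have h := hB g g
  have ha : Additive.ofMul (Abelianization.of g) = a := hg
  rw [ha] at h
  exact Subtype.ext (h.trans (by group; rfl))

theorem commutatorPairing_eq_zero_iff (a b : G) :
    B (Additive.ofMul (Abelianization.of a)) (Additive.ofMul (Abelianization.of b)) = 0 ↔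
      a * b = b * a := by
  have h : B (Additive.ofMul (Abelianization.of a)) (Additive.ofMul (Abelianization.of b)) = 0 ↔
      a * b * a⁻¹ * b⁻¹ = 1 := by
    rw [← hB]
    exact ⟨fun h => by rw [h]; rfl, fun h => Subtype.ext h⟩
  rw [h, mul_inv_eq_one, mul_inv_eq_iff_eq_mul]

theorem IsSpecialPGroup.commutatorPairing_nondegenerate {p : ℕ} (hG : IsSpecialPGroup p G)
    (a : Additive (Abelianization G)) (ha : ∀ b, B a b = 0) : a = 0 := by
  obtain ⟨g, hg⟩ := QuotientGroup.mk_surjective a.toMul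
  obtain rfl : Additive.ofMul (Abelianization.of g) = a := hg
  rw [← ofMul_one]
  congr 1
  rw [hG.of_eq_one_iff, Subgroup.mem_center_iff]
  exact fun b => ((commutatorPairing_eq_zero_iff hB g b).1 (ha _)).symm

/-- Reordering `g h g h` into `g² h²` costs one commutator, which is a central involution. -/
theorem square_map_add [CharP F 2]
    {Q : Additive (Abelianization G) → Additive (Subgroup.center G)}
    (hQ : ∀ g : G, ((Q (Additive.ofMul (Abelianization.of g))).toMul : G) = g * g)
    (a b : Additive (Abelianization G)) : Q (a + b) = Q a + Q b + B a b := by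
  obtain ⟨g, hg⟩ := QuotientGroup.mk_surjective a.toMul
  obtain ⟨h, hh⟩ := QuotientGroup.mk_surjective b.toMul
  obtain rfl : Additive.ofMul (Abelianization.of g) = a := hg
  obtain rfl : Additive.ofMul (Abelianization.of h) = b := hh
  apply Subtype.ext
  have h3 := hQ (g * h)
  rw [map_mul, ofMul_mul] at h3
  refine h3.trans ?_
  change g * h * (g * h) = (Q _).toMul * (Q _).toMul * (B _ _).toMul
  rw [hQ, hQ]
  set z := (B (Additive.ofMul (Abelianization.of g)) (Additive.ofMul (Abelianization.of h))).toMul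
    with hz
  have h4 : (z : G)⁻¹ = z := by
    rw [inv_eq_iff_mul_eq_one]
    exact congrArg Subtype.val (center_mul_self (F := F) z)
  have h5 := Subgroup.mem_center_iff.1 z.2
  calc g * h * (g * h) = g * ((z : G)⁻¹ * (g * h)) * h := by rw [hz, hB]; group
    _ = g * z * (g * h * h) := by rw [h4]; group
    _ = z * (g * g * (h * h)) := by rw [h5]; group
    _ = g * g * (h * h) * z := (h5 _).symm

omit hB

/-- The commutator pairing followed by a sign character of the center. -/
noncomputable def signPairing (B : Additive (Abelianization G) →ₗ[F]
    Additive (Abelianization G) →ₗ[F] Additive (Subgroup.center G))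
    (lam : Subgroup.center G →* ℤˣ) : G →* G →* ℤˣ :=
  MonoidHom.mk' (fun g => MonoidHom.mk' (fun h => lam
      (B (Additive.ofMul (Abelianization.of g)) (Additive.ofMul (Abelianization.of h))).toMul)
    fun h h' => by simp) fun g g' => by ext; simp

/-- A character of the preimage of a Lagrangian is polarizing. -/
theorem IsSpecialPGroup.exists_polarization [Finite F] [CharP F 2] [Finite G]
    (hG : IsSpecialPGroup 2 G) (hord : ∀ g : G, g ∉ Subgroup.center G → orderOf g = 4)
    (hdim : Module.finrank F (Additive (Subgroup.center G)) = 1)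
    (hB : ∀ a b : G,
      ((B (Additive.ofMul (Abelianization.of a)) (Additive.ofMul (Abelianization.of b))).toMul : G)
        = a * b * a⁻¹ * b⁻¹)
    {L : Submodule F (Additive (Abelianization G))} (hL : IsLagrangian B L)
    (x : Hyperplane 2 (Subgroup.center G)) (χ : abPreimage L →* GaussianFieldˣ)
    (hχ : (χ.comp (Subgroup.inclusion (hG.center_le L))).ker = x.1) :
    ∃ (lam : Subgroup.center G →* ℤˣ) (β : G →* G →* ℤˣ) (N : Subgroup G) (h₀ g₀ : G),
      (∀ z, lam z = 1 ↔ z ∈ x.1) ∧ IsQuaternionicPolarization lam β N h₀ g₀ ∧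
        IsPolarizingCharacter lam N h₀ χ := by
  have halt := commutatorPairing_isAlt hB
  have hnd := hG.commutatorPairing_nondegenerate hB
  obtain ⟨Q, hQ⟩ := hG.exists_square_map (F := F)
  have hQadd := square_map_add hB hQ
  -- Anisotropy: an element of square one does not have order four, so it is central.
  have hQ0 : ∀ a, Q a = 0 → a = 0 := by
    intro a ha
    obtain ⟨g, hg⟩ := QuotientGroup.mk_surjective a.toMul
    obtain rfl : Additive.ofMul (Abelianization.of g) = a := hg
    have h1 : g * g = 1 := by
      rw [← hQ, ha]
      rfl
    rw [← ofMul_one]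
    congr 1
    rw [hG.of_eq_one_iff]
    by_contra hgc
    have h2 := orderOf_dvd_of_pow_eq_one ((pow_two g).trans h1)
    rw [hord g hgc] at h2
    omega
  let lam := indexTwoSign x.1 x.2
  have hlam : ∀ z, lam z = 1 ↔ z ∈ x.1 := fun z => indexTwoSign_eq_one_iff x.2
  obtain ⟨zx, hzx⟩ : ∃ z, z ∉ x.1 := by
    by_contra! h
    have h1 : x.1 = ⊤ := (Subgroup.eq_top_iff' _).2 h
    have h2 := x.2
    rw [h1, Subgroup.index_top] at h2
    omega
  have hzx' : lam zx = -1 := (Int.units_eq_one_or _).resolve_left fun h => hzx ((hlam zx).1 h)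
  obtain ⟨f, hf⟩ := exists_addMonoidHom_of_sign lam
  have hf0 : f ≠ 0 := by
    intro h
    have h1 := (hf zx 1).1 (by rw [h]; rfl)
    rw [map_one] at h1
    exact hzx ((hlam zx).1 h1)
  have hf1 : ∀ z, f (Additive.ofMul z) = 0 ↔ lam z = 1 := fun z => by
    rw [← map_one lam, ← hf, ofMul_one, map_zero]
  -- If `Gᵃᵇ` were trivial, `G` would be abelian and the center, being the commutator subgroup,
  -- trivial; but `zx ≠ 1`.
  have hnt : Nontrivial (Additive (Abelianization G)) := by
    by_contra h
    rw [not_nontrivial_iff_subsingleton] at h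
    have hall : ∀ g : G, g ∈ Subgroup.center G := fun g => by
      rw [← hG.of_eq_one_iff]
      exact Subsingleton.elim (α := Additive (Abelianization G)) _ _
    have h1 : (⊤ : Subgroup G) ≤ Subgroup.center G := fun g _ => hall g
    have h2 : commutator G = ⊥ := by
      rw [commutator_def, Subgroup.commutator_eq_bot_iff_le_centralizer]
      exact h1.trans (by rw [Subgroup.coe_top, Subgroup.centralizer_univ])
    rw [hG.commutator_eq] at h2
    have h3 : (zx : G) ∈ (⊥ : Subgroup G) := h2 ▸ zx.2
    refine hzx ?_
    have h4 : zx = 1 := Subtype.ext (Subgroup.mem_bot.1 h3)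
    rw [h4]
    exact x.1.one_mem
  let β := signPairing B lam
  have hβ : ∀ g h, β g h = lam
      (B (Additive.ofMul (Abelianization.of g)) (Additive.ofMul (Abelianization.of h))).toMul :=
    fun _ _ => rfl
  have hsymm : ∀ g h, β g h = β h g := by
    intro g h
    rw [hβ, hβ, ← halt.neg, toMul_neg, map_inv, Int.units_inv_eq_self]
  have hβc : ∀ g (z : Subgroup.center G), β g z = 1 := by
    intro g z
    rw [hβ, (hG.of_eq_one_iff (z : G)).2 z.2, ofMul_one, map_zero, toMul_zero, map_one]
  have hβH : ∀ g ∈ abPreimage L, ∀ h ∈ abPreimage L, β g h = 1 := by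
    intro g hg h hh
    have h1 : B (Additive.ofMul (Abelianization.of g)) (Additive.ofMul (Abelianization.of h)) = 0 :=
      hL.1 _ hg _ hh
    rw [hβ, h1, toMul_zero, map_one]
  have hcommH : ∀ g ∈ abPreimage L, ∀ h ∈ abPreimage L, g * h = h * g := fun g hg h hh =>
    (commutatorPairing_eq_zero_iff hB g h).1 (hL.1 _ hg _ hh)
  have hperp : ∀ g, (∀ h ∈ abPreimage L, β g h = 1) → g ∈ abPreimage L := by
    intro g hg
    rw [mem_abPreimage]
    refine hL.mem_of_forall_character_eq_zero halt hdim hf0 fun l hl => ?_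
    obtain ⟨h, hh⟩ := QuotientGroup.mk_surjective l.toMul
    obtain rfl : Additive.ofMul (Abelianization.of h) = l := hh
    exact (hf1 _).2 (hg h hl)
  let s : G → ℤˣ := fun g => lam ⟨g * g, hG.mul_self_mem_center (F := F) g⟩
  have hχc : ∀ z : Subgroup.center G,
      (χ (Subgroup.inclusion (hG.center_le L) z) : GaussianField) = (lam z : ℤ) := by
    intro z
    rcases Int.units_eq_one_or (lam z) with h | h
    · have h1 : z ∈ (χ.comp (Subgroup.inclusion (hG.center_le L))).ker := hχ ▸ (hlam z).1 h
      rw [MonoidHom.mem_ker, MonoidHom.comp_apply] at h1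
      rw [h, h1]
      simp
    · have h1 : χ (Subgroup.inclusion (hG.center_le L) z) ≠ 1 := by
        intro h1
        have h2 : z ∈ (χ.comp (Subgroup.inclusion (hG.center_le L))).ker := h1
        rw [hχ, ← hlam, h] at h2
        exact absurd h2 (by decide)
      have h2 : χ (Subgroup.inclusion (hG.center_le L) z) *
          χ (Subgroup.inclusion (hG.center_le L) z) = 1 := by
        rw [← map_mul, ← map_mul, center_mul_self (F := F), map_one, map_one]
      have h3 := congrArg Units.val h2
      rw [Units.val_mul, Units.val_one, mul_self_eq_one_iff] at h3
      rw [h, h3.resolve_left fun h4 => h1 (Units.ext h4)]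
      simp
  have hχsq : ∀ h : abPreimage L, (χ h : GaussianField) * χ h = (s h : ℤ) := by
    intro h
    rw [← Units.val_mul, ← map_mul]
    exact hχc ⟨h * h, hG.mul_self_mem_center (F := F) (h : G)⟩
  let N : Subgroup G := χ.ker.map (abPreimage L).subtype
  have hN : ∀ h : abPreimage L, χ h = 1 → (h : G) ∈ N := fun h hh => ⟨h, hh, rfl⟩
  have hN' : ∀ n ∈ N, ∃ h : abPreimage L, (h : G) = n ∧ χ h = 1 := by
    rintro _ ⟨h, hh, rfl⟩
    exact ⟨h, rfl, hh⟩
  -- an element of the preimage on which the character is `i`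
  obtain ⟨h₀, hh₀⟩ : ∃ h : abPreimage L, (χ h : GaussianField) = gaussianI := by
    -- A lift `h` of a vector of `L` with square `zx` has `χ h ^ 2 = -1`, so `h` or its inverse has
    -- value `i`.
    obtain ⟨l, hl, hlz⟩ := hL.exists_quadratic_eq halt hdim hQadd hQ0 (Additive.ofMul zx)
    obtain ⟨h, hh⟩ := QuotientGroup.mk_surjective l.toMul
    obtain rfl : Additive.ofMul (Abelianization.of h) = l := hh
    have h1 : s h = -1 := by
      rw [← hzx']
      refine congrArg lam (Subtype.ext ?_)
      change h * h = zx
      rw [← hQ, hlz]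
      rfl
    have h2 := hχsq ⟨h, hl⟩
    rw [h1, Units.val_neg, Units.val_one, Int.cast_neg, Int.cast_one, ← gaussianI_mul_self,
      mul_self_eq_mul_self_iff] at h2
    rcases h2 with h2 | h2
    · exact ⟨⟨h, hl⟩, h2⟩
    · refine ⟨⟨h, hl⟩⁻¹, ?_⟩
      rw [map_inv, Units.val_inv_eq_inv_val, h2]
      exact inv_eq_of_mul_eq_one_right (by rw [neg_mul, gaussianI_mul_self, neg_neg])
  have hs₀ : s h₀ = -1 := by
    have h1 := hχsq h₀
    rw [hh₀, gaussianI_mul_self] at h1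
    rcases Int.units_eq_one_or (s h₀) with h | h
    · rw [h] at h1
      norm_num at h1
    · exact h
  have hcover1 : ∀ h : abPreimage L, (χ h : GaussianField) * χ h = 1 →
      ∃ z : Subgroup.center G, ∃ n ∈ N, (h : G) = n * z := by
    intro h hh
    rcases mul_self_eq_one_iff.1 hh with h1 | h1
    · exact ⟨1, h, hN h (Units.ext h1), by simp⟩
    -- The central element `h₀²` has value `-1`; dividing by it moves `h` into `N`.
    · let z : Subgroup.center G := ⟨h₀ * h₀, hG.mul_self_mem_center (F := F) (h₀ : G)⟩
      refine ⟨z, h * (h₀ * h₀)⁻¹, hN (h * (h₀ * h₀)⁻¹) (Units.ext ?_), ?_⟩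
      swap
      · exact (inv_mul_cancel_right (h : G) ((h₀ : G) * h₀)).symm
      rw [map_mul, map_inv, map_mul, Units.val_mul, Units.val_inv_eq_inv_val, Units.val_mul, hh₀,
        gaussianI_mul_self, h1]
      norm_num
  have hcover : ∀ h : abPreimage L, ∃ z : Subgroup.center G, ∃ n ∈ N,
      (h : G) = n * z ∨ (h : G) = h₀ * n * z := by
    intro h
    have h1 := hχsq h
    rcases Int.units_eq_one_or (s h) with hs | hs
    · rw [hs] at h1
      obtain ⟨z, n, hn, h2⟩ := hcover1 h (by simpa using h1)
      exact ⟨z, n, hn, Or.inl h2⟩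
    · rw [hs] at h1
      obtain ⟨z, n, hn, h2⟩ := hcover1 (h₀⁻¹ * h) <| by
        rw [map_mul, map_inv, Units.val_mul, Units.val_inv_eq_inv_val, hh₀, mul_mul_mul_comm, h1,
          ← mul_inv, gaussianI_mul_self]
        norm_num
      refine ⟨z, n, hn, Or.inr ?_⟩
      rw [mul_assoc, ← h2]
      simp
  -- an element outside of the preimage whose commutators with the preimage are the squares
  obtain ⟨v, hv, hv1⟩ := hL.exists_forall_character_eq halt hnd hdim hQadd hQ0 hf0
  obtain ⟨g₀, hg₀⟩ := QuotientGroup.mk_surjective v.toMul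
  obtain rfl : Additive.ofMul (Abelianization.of g₀) = v := hg₀
  have hQs : ∀ g, lam (Q (Additive.ofMul (Abelianization.of g))).toMul = s g := fun g =>
    congrArg lam (Subtype.ext (hQ g))
  have hβg₀ : ∀ h ∈ abPreimage L, β g₀ h = s h := by
    intro h hh
    rw [← hQs]
    exact (hf _ _).1 (hv _ hh)
  have hsg₀ : s g₀ = -1 := by
    refine (Int.units_eq_one_or _).resolve_left fun h => ?_
    rw [← hQs] at h
    have h2 : f (Q (Additive.ofMul (Abelianization.of g₀))) = 0 := (hf1 _).2 h
    rw [hv1] at h2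
    exact one_ne_zero h2
  have hsN : ∀ n ∈ N, s n = 1 := by
    intro n hn
    obtain ⟨h, rfl, hh⟩ := hN' n hn
    have h1 := hχsq h
    rw [hh] at h1
    rcases Int.units_eq_one_or (s h) with h2 | h2
    · exact h2
    · rw [h2] at h1
      norm_num at h1
  have hNH : ∀ n ∈ N, n ∈ abPreimage L := fun n hn => by
    obtain ⟨h, rfl, -⟩ := hN' n hn
    exact h.2
  -- `H` is made up of `N`, `h₀` and the center, so orthogonality to `N` and `h₀` is orthogonality
  -- to `H`.
  have hperp' : ∀ g, (∀ n ∈ N, β g n = 1) → β g h₀ = 1 → g ∈ abPreimage L := by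
    intro g hg hg'
    refine hperp g fun h hh => ?_
    obtain ⟨z, n, hn, h1 | h1⟩ := hcover ⟨h, hh⟩
    · change h = n * z at h1
      rw [h1, map_mul, hg n hn, hβc, mul_one]
    · change h = h₀ * n * z at h1
      rw [h1, map_mul, map_mul, hg n hn, hβc, hg', mul_one, mul_one]
  have hs₀' : β g₀ h₀ = -1 := (hβg₀ _ h₀.2).trans hs₀
  refine ⟨lam, β, N, h₀, g₀, hlam, ?_, ?_⟩
  · constructor
    · exact fun g h => ⟨_, hB g h, rfl⟩
    · intro n hn
      rw [← hG.of_eq_one_iff]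
      refine hnd (Additive.ofMul (Abelianization.of n)) fun b => ?_
      by_contra hb
      obtain ⟨b, hb⟩ := exists_character_ne_zero hdim hf0 ⟨b, hb⟩
      obtain ⟨g, hg⟩ := QuotientGroup.mk_surjective b.toMul
      obtain rfl : Additive.ofMul (Abelianization.of g) = b := hg
      exact hb ((hf1 _).2 ((hsymm n g).trans (hn g)))
    · intro z hz
      obtain ⟨h, hh, hh1⟩ := hN' z hz
      have h1 : h = Subgroup.inclusion (hG.center_le L) z := Subtype.ext hh
      have h2 : z ∈ (χ.comp (Subgroup.inclusion (hG.center_le L))).ker := by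
        rw [h1] at hh1
        exact hh1
      rw [hχ] at h2
      exact (hlam z).2 h2
    · exact ⟨_, rfl, hs₀⟩
    · exact ⟨_, rfl, hsg₀⟩
    · exact fun n hn => hβH n (hNH n hn) h₀ h₀.2
    · exact fun n hn => by rw [hsymm, hβg₀ n (hNH n hn), hsN n hn]
    · rw [hsymm, hs₀']
    · intro g hg
      rcases Int.units_eq_one_or (β g h₀) with h | h
      · obtain ⟨z, n, hn, h1⟩ := hcover ⟨g, hperp' g (fun n hn => by rw [hsymm, hg n hn]) h⟩
        exact ⟨z, n, hn, h1.elim Or.inl fun h => Or.inr (Or.inl h)⟩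
      -- Both `g` and `g₀` are orthogonal to `N` and have sign `-1` against `h₀`, so the signs of
      -- the quotient cancel.
      · have hmem : g₀⁻¹ * g ∈ abPreimage L := by
          refine hperp' _ (fun n hn => ?_) ?_
          · rw [map_mul, map_inv, MonoidHom.mul_apply, MonoidHom.inv_apply, hsymm g, hg n hn,
              hβg₀ n (hNH n hn), hsN n hn]
            simp
          · rw [map_mul, map_inv, MonoidHom.mul_apply, MonoidHom.inv_apply, hs₀', h]
            decide
        obtain ⟨z, n, hn, h1⟩ := hcover ⟨_, hmem⟩
        refine ⟨z, n, hn, Or.inr (Or.inr (h1.imp (fun h => ?_) fun h => ?_))⟩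
        · rw [mul_assoc, ← h]
          simp
        · rw [mul_assoc, mul_assoc, ← mul_assoc (h₀ : G), ← h]
          simp
  · constructor
    · exact fun z => ⟨_, rfl, hχc z⟩
    · exact hN'
    · exact ⟨h₀, rfl, hh₀⟩
    · exact fun h hh => hcommH h hh h₀ h₀.2
    · exact hcover

end Polarization

/-! ### Irreducible representations and sign characters. -/

section Irreducibility

open Representation

variable {K G W W' : Type*} [Field K] [Group G] [AddCommGroup W] [Module K W]
  [AddCommGroup W'] [Module K W'] {ρ : Representation K G W} {σ : Representation K G W'}

theorem isIrreducible_iff_forall : ρ.IsIrreducible ↔ Nontrivial W ∧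
    ∀ S : Submodule K W, (∀ g, ∀ v ∈ S, ρ g v ∈ S) → S = ⊥ ∨ S = ⊤ := by
  constructor
  · intro h
    constructor
    · obtain ⟨S, S', hne⟩ := h.exists_pair_ne
      by_contra hW
      rw [not_nontrivial_iff_subsingleton] at hW
      exact hne (Subrepresentation.toSubmodule_injective (Subsingleton.elim _ _))
    · intro S hS
      exact (h.eq_bot_or_eq_top ⟨S, fun g v hv => hS g v hv⟩).imp
        (congrArg Subrepresentation.toSubmodule) (congrArg Subrepresentation.toSubmodule)
  · rintro ⟨hW, h⟩
    have hnt : Nontrivial (Subrepresentation ρ) := by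
      refine ⟨⊥, ⊤, fun h => ?_⟩
      exact bot_ne_top (α := Submodule K W) (congrArg Subrepresentation.toSubmodule h)
    refine ⟨fun S => ?_⟩
    exact (h S.toSubmodule fun g v hv => S.apply_mem_toSubmodule g hv).imp
      (fun h => Subrepresentation.toSubmodule_injective h)
      fun h => Subrepresentation.toSubmodule_injective h

theorem isIrreducible_of_equiv (e : ρ.Equiv σ) (h : σ.IsIrreducible) : ρ.IsIrreducible := by
  rw [isIrreducible_iff_forall] at h ⊢
  obtain ⟨hW, h⟩ := h
  refine ⟨e.toLinearEquiv.toEquiv.nontrivial, fun S hS => ?_⟩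
  have hcomm : ∀ g v, e.symm (σ g v) = ρ g (e.symm v) :=
    fun g v => IntertwiningMap.isIntertwining _ _ e.symm.toIntertwiningMap g v
  have hmem : ∀ v, e.toLinearEquiv v ∈ S.comap e.toLinearEquiv.symm.toLinearMap ↔ v ∈ S :=
    fun v => iff_of_eq (congrArg (· ∈ S) (e.toLinearEquiv.symm_apply_apply v))
  refine (h (S.comap e.toLinearEquiv.symm.toLinearMap) fun g v hv => ?_).imp (fun h => ?_)
    fun h => ?_
  · change e.symm (σ g v) ∈ S
    rw [hcomm]
    exact hS g _ hv
  · rw [eq_bot_iff]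
    intro v hv
    have h1 : e.toLinearEquiv v ∈ S.comap e.toLinearEquiv.symm.toLinearMap := by
      rwa [hmem]
    rw [h, Submodule.mem_bot] at h1
    simpa using h1
  · rw [eq_top_iff]
    intro v _
    have h1 : e.toLinearEquiv v ∈ S.comap e.toLinearEquiv.symm.toLinearMap := h ▸ trivial
    rwa [hmem] at h1

theorem nonempty_equiv_of_ne_zero (hρ : ρ.IsIrreducible) (hσ : σ.IsIrreducible)
    {f : ρ.IntertwiningMap σ} {v : W} (hf : f v ≠ 0) : Nonempty (ρ.Equiv σ) := by
  rcases IsIrreducible.bijective_or_eq_zero f with h | h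
  · exact ⟨Representation.Equiv.mk (LinearEquiv.ofBijective f.toLinearMap h) f.isIntertwining'⟩
  · exact absurd (by rw [h]; rfl) hf

/-- The group acts by the signs `ε`. -/
def ActsBySign (ρ : Representation K G W) (ε : G →* ℤˣ) : Prop :=
  ∀ g w, ρ g w = ε g • w

theorem isIrreducible_of_finrank_eq_one (h : Module.finrank K W = 1) : ρ.IsIrreducible := by
  have := isSimpleModule_iff_finrank_eq_one.2 h
  rw [isIrreducible_iff_forall]
  exact ⟨IsSimpleModule.nontrivial K W, fun S _ => eq_bot_or_eq_top S⟩

theorem ActsBySign.finrank_eq_one {ε : G →* ℤˣ} (hε : ActsBySign ρ ε) (hρ : ρ.IsIrreducible) :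
    Module.finrank K W = 1 := by
  obtain ⟨hW, h⟩ := isIrreducible_iff_forall.1 hρ
  obtain ⟨w, hw⟩ := exists_ne (0 : W)
  rw [finrank_eq_one_iff_of_nonzero w hw]
  refine (h _ fun g v hv => ?_).resolve_left fun h => hw (Submodule.span_singleton_eq_bot.1 h)
  rw [hε, Units.smul_def]
  exact zsmul_mem hv _

theorem ActsBySign.nonempty_equiv {ε : G →* ℤˣ} (hρ : ActsBySign ρ ε) (hσ : ActsBySign σ ε)
    (h : Module.finrank K W = 1) (h' : Module.finrank K W' = 1) : Nonempty (ρ.Equiv σ) := by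
  have := Module.finite_of_finrank_eq_succ h
  have := Module.finite_of_finrank_eq_succ h'
  let e := LinearEquiv.ofFinrankEq W W' (h.trans h'.symm)
  refine ⟨Representation.Equiv.mk e fun g => LinearMap.ext fun w => ?_⟩
  change e (ρ g w) = σ g (e w)
  rw [hρ, hσ, Units.smul_def, Units.smul_def, map_zsmul]

theorem units_smul_injective [CharZero K] {w : W} (hw : w ≠ 0) {e e' : ℤˣ} (h : e • w = e' • w) :
    e = e' := by
  have h1 : (((e : ℤ) : K) - ((e' : ℤ) : K)) • w = 0 := by
    rw [sub_smul, Int.cast_smul_eq_zsmul, Int.cast_smul_eq_zsmul, ← Units.smul_def,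
      ← Units.smul_def, h, sub_self]
  have h2 := sub_eq_zero.1 ((smul_eq_zero.1 h1).resolve_right hw)
  exact Units.ext (Int.cast_injective h2)

/-- A group of central involutions acts on an irreducible representation by signs. -/
theorem exists_sign_of_isIrreducible [CharZero K] (hρ : ρ.IsIrreducible) {M : Type*} [Group M]
    (j : M →* G) (hsq : ∀ m w, ρ (j m) (ρ (j m) w) = w)
    (hcomm : ∀ m g w, ρ (j m) (ρ g w) = ρ g (ρ (j m) w)) :
    ∃ ε : M →* ℤˣ, ∀ m w, ρ (j m) w = ε m • w := by
  obtain ⟨hW, h⟩ := isIrreducible_iff_forall.1 hρ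
  have hex : ∀ m, ∃ e : ℤˣ, ∀ w, ρ (j m) w = e • w := by
    intro m
    -- The fixed space of `j m` is invariant. If it is zero, then `ρ (j m) w + w`, which is fixed,
    -- vanishes, and `j m` acts as `-1`.
    rcases h (LinearMap.ker (ρ (j m) - 1)) fun g v hv => by
      rw [LinearMap.mem_ker, LinearMap.sub_apply, Module.End.one_apply, sub_eq_zero] at hv ⊢
      rw [hcomm, hv] with h1 | h1
    · refine ⟨-1, fun w => ?_⟩
      have h2 : ρ (j m) w + w ∈ LinearMap.ker (ρ (j m) - 1) := by
        rw [LinearMap.mem_ker, LinearMap.sub_apply, Module.End.one_apply, map_add, hsq, add_comm,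
          sub_self]
      rw [h1, Submodule.mem_bot] at h2
      rw [eq_neg_of_add_eq_zero_left h2]
      simp
    · refine ⟨1, fun w => ?_⟩
      have h2 : w ∈ LinearMap.ker (ρ (j m) - 1) := h1 ▸ trivial
      rw [LinearMap.mem_ker, LinearMap.sub_apply, Module.End.one_apply, sub_eq_zero] at h2
      rw [h2, one_smul]
  choose ε hε using hex
  obtain ⟨w, hw⟩ := exists_ne (0 : W)
  refine ⟨MonoidHom.mk' ε fun m m' => units_smul_injective (K := K) hw ?_, hε⟩
  rw [← hε, map_mul, map_mul, Module.End.mul_apply, hε, hε, mul_smul]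

theorem sign_eq_of_equiv [CharZero K] [Nontrivial W] (e : ρ.Equiv σ) {g : G} {s s' : ℤˣ}
    (hs : ∀ w, ρ g w = s • w) (hs' : ∀ w, σ g w = s' • w) : s = s' := by
  obtain ⟨w, hw⟩ := exists_ne (0 : W)
  refine units_smul_injective (K := K) hw (e.toLinearEquiv.injective ?_)
  have h1 : e (ρ g w) = σ g (e w) := IntertwiningMap.isIntertwining _ _ e.toIntertwiningMap g w
  rw [hs, hs', Units.smul_def, Units.smul_def, map_zsmul] at h1
  rw [Units.smul_def, Units.smul_def, map_zsmul, map_zsmul]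
  exact h1

theorem sign_ext {A : Type*} [Group A] {e e' : A →* ℤˣ} (h : ∀ a, e a = 1 ↔ e' a = 1) : e = e' := by
  ext a : 1
  rcases Int.units_eq_one_or (e a) with h1 | h1
  · rw [h1, (h a).1 h1]
  · rcases Int.units_eq_one_or (e' a) with h2 | h2
    · rw [h2, (h a).2 h2]
    · rw [h1, h2]

theorem index_ker_of_sign_ne_one {A : Type*} [Group A] {e : A →* ℤˣ} (he : e ≠ 1) :
    e.ker.index = 2 := by
  have hsurj : Function.Surjective e := by
    obtain ⟨a, ha⟩ : ∃ a, e a ≠ 1 := by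
      by_contra! h
      exact he (MonoidHom.ext h)
    intro s
    rcases Int.units_eq_one_or s with rfl | rfl
    · exact ⟨1, map_one e⟩
    · exact ⟨a, (Int.units_eq_one_or _).resolve_left ha⟩
  rw [Subgroup.index_ker, MonoidHom.range_eq_top.2 hsurj, Nat.card_congr Subgroup.topEquiv.toEquiv]
  simp

end Irreducibility

/-! ### Endomorphisms, irreducibility and uniqueness of `K ⊗ 2V_x`. -/

section RepTwoVExtended

theorem rat_three_squares_anisotropic :
    ¬ ∃ t₀ t₁ t₂ : ℚ, (t₀, t₁, t₂) ≠ (0, 0, 0) ∧ t₀ ^ 2 + t₁ ^ 2 + t₂ ^ 2 = 0 := by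
  rintro ⟨t₀, t₁, t₂, hne, ht⟩
  refine hne ?_
  have h0 : t₀ ^ 2 = 0 := by nlinarith [sq_nonneg t₀, sq_nonneg t₁, sq_nonneg t₂]
  have h1 : t₁ ^ 2 = 0 := by nlinarith [sq_nonneg t₀, sq_nonneg t₁, sq_nonneg t₂]
  have h2 : t₂ ^ 2 = 0 := by nlinarith [sq_nonneg t₀, sq_nonneg t₁, sq_nonneg t₂]
  rw [pow_eq_zero_iff two_ne_zero] at h0 h1 h2
  rw [h0, h1, h2]

open Representation

variable {G : Type u} [Group G] {lam : Subgroup.center G →* ℤˣ} {β : G →* G →* ℤˣ}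
  {N : Subgroup G} {h₀ g₀ : G} {H : Subgroup G} {χ : H →* GaussianFieldˣ}

instance indCharRep_nontrivial : Nontrivial (IndV H.subtype (charRep ℚ χ)) :=
  ⟨_, _, indCharRepGen_ne_zero (χ := χ)⟩

/-- This makes `ρ h₀ w` an admissible target for the universal property, which yields the
endomorphism `I`. -/
theorem IsQuaternionicPolarization.fixed_h₀ {K W : Type*} [Field K] [AddCommGroup W] [Module K W]
    (hP : IsQuaternionicPolarization lam β N h₀ g₀) {ρ : Representation K G W}
    (hρ : HasCentralSign ρ lam) {w : W} (hw : ∀ n ∈ N, ρ n w = w) :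
    ∀ n ∈ N, ρ n (ρ h₀ w) = ρ h₀ w := fun n hn => by
  rw [hP.apply_apply_comm hρ, hP.orthogonal_h₀ n hn, one_smul, hw n hn]

theorem IsQuaternionicPolarization.fixed_g₀ {K W : Type*} [Field K] [AddCommGroup W] [Module K W]
    (hP : IsQuaternionicPolarization lam β N h₀ g₀) {ρ : Representation K G W}
    (hρ : HasCentralSign ρ lam) {w : W} (hw : ∀ n ∈ N, ρ n w = w) :
    ∀ n ∈ N, ρ n (ρ g₀ w) = ρ g₀ w := fun n hn => by
  rw [hP.apply_apply_comm hρ, hP.orthogonal_g₀ n hn, one_smul, hw n hn]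

namespace IsPolarizingCharacter

variable (hχ : IsPolarizingCharacter lam N h₀ χ) (hP : IsQuaternionicPolarization lam β N h₀ g₀)

include hχ hP

theorem nonempty_algEquiv [Finite G] :
    Nonempty ((indCharRep χ).IntertwiningMap (indCharRep χ) ≃ₐ[ℚ] ℍ[ℚ, -1, -1]) := by
  have hρ := hχ.indCharRep_hasCentralSign
  have hfix := hχ.indCharRep_fixed
  obtain ⟨I, hI⟩ := hχ.exists_intertwiningMap hP hρ (hP.fixed_h₀ hρ hfix)
  obtain ⟨J, hJ⟩ := hχ.exists_intertwiningMap hP hρ (hP.fixed_g₀ hρ hfix)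
  refine ⟨(AlgEquiv.ofBijective (hP.quaternionHom hρ hχ.indCharRep_span hI hJ)
    (hP.quaternionHom_bijective hρ hχ.indCharRep_span hI hJ hfix
      rat_three_squares_anisotropic)).symm⟩

variable (K : Type*) [Field K] [Algebra ℚ K]

theorem baseChange_exists_intertwiningMap {W : Type*} [AddCommGroup W] [Module K W]
    {σ : Representation K G W} (hσ : HasCentralSign σ lam) {w : W} (hw : ∀ n ∈ N, σ n w = w) :
    ∃ F : (baseChangeRep K (indCharRep χ)).IntertwiningMap σ,
      F (1 ⊗ₜ[ℚ] indCharRepGen χ) = w :=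
  baseChangeRep_exists_intertwiningMap K σ fun _ hτ =>
    hχ.exists_intertwiningMap hP (fun z w => (hτ z w).trans (hσ z w))
      fun n hn => (hτ n w).trans (hw n hn)

theorem baseChange_isIrreducible_iff [Finite G] :
    (baseChangeRep K (indCharRep χ)).IsIrreducible ↔
      ¬ ∃ t₀ t₁ t₂ : K, (t₀, t₁, t₂) ≠ (0, 0, 0) ∧ t₀ ^ 2 + t₁ ^ 2 + t₂ ^ 2 = 0 := by
  have : CharZero K := algebraRat.charZero K
  have hρ := baseChangeRep_hasCentralSign K hχ.indCharRep_hasCentralSign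
  have hgen := baseChangeRep_span K hχ.indCharRep_span
  have hfix : ∀ n ∈ N, baseChangeRep K (indCharRep χ) n (1 ⊗ₜ[ℚ] indCharRepGen χ) =
      1 ⊗ₜ[ℚ] indCharRepGen χ := fun n hn => by
    rw [baseChangeRep_apply_tmul, hχ.indCharRep_fixed n hn]
  obtain ⟨I, hI⟩ := hχ.baseChange_exists_intertwiningMap hP K hρ (hP.fixed_h₀ hρ hfix)
  obtain ⟨J, hJ⟩ := hχ.baseChange_exists_intertwiningMap hP K hρ (hP.fixed_g₀ hρ hfix)
  refine ⟨fun h hK => ?_, fun hK => ?_⟩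
  · exact hP.not_isIrreducible hρ hgen hI hJ hK h
  · exact hP.isIrreducible hρ hgen hI hJ hfix hK

/-- A nonzero `N`-fixed vector of `σ` gives a nonzero map from the irreducible `K ⊗ 2V_x`, an
isomorphism by Schur's lemma. -/
theorem nonempty_equiv_baseChange [Finite G]
    (hK : ¬ ∃ t₀ t₁ t₂ : K, (t₀, t₁, t₂) ≠ (0, 0, 0) ∧ t₀ ^ 2 + t₁ ^ 2 + t₂ ^ 2 = 0)
    {W : Type*} [AddCommGroup W] [Module K W] {σ : Representation K G W}
    (hσ : HasCentralSign σ lam) (hirr : σ.IsIrreducible) :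
    Nonempty (σ.Equiv (baseChangeRep K (indCharRep χ))) := by
  have : CharZero K := algebraRat.charZero K
  obtain ⟨hW, -⟩ := isIrreducible_iff_forall.1 hirr
  obtain ⟨w, hw0, hw⟩ := hP.exists_fixed hσ
  obtain ⟨F, hF⟩ := hχ.baseChange_exists_intertwiningMap hP K hσ hw
  obtain ⟨e⟩ := nonempty_equiv_of_ne_zero ((hχ.baseChange_isIrreducible_iff hP K).2 hK) hirr
    (hF.trans_ne hw0)
  exact ⟨e.symm⟩

end IsPolarizingCharacter

end RepTwoVExtended

/-! ### Transport of basic sets, and the one-dimensional members. -/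

section BasicSet

open Representation

theorem IsBasicSet.of_equiv {K : Type u} {G : Type v} [Field K] [Group G] {ι : Type*}
    {V V' : ι → Rep.{w} K G} (h : IsBasicSet V') (e : ∀ i, Nonempty ((V i).ρ.Equiv (V' i).ρ)) :
    IsBasicSet V where
  finiteDimensional i := by
    obtain ⟨e⟩ := e i
    have := h.finiteDimensional i
    exact Module.Finite.equiv e.toLinearEquiv.symm
  irreducible i := by
    obtain ⟨e⟩ := e i
    exact isIrreducible_of_equiv e (h.irreducible i)
  pairwise i j := by
    rintro ⟨f⟩
    obtain ⟨ei⟩ := e i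
    obtain ⟨ej⟩ := e j
    exact h.pairwise i j ⟨(ei.symm.trans f).trans ej⟩
  exhaustive W _ _ _ σ hσ := by
    obtain ⟨i, ⟨f⟩⟩ := h.exhaustive W σ hσ
    obtain ⟨ei⟩ := e i
    exact ⟨i, ⟨f.trans ei.symm⟩⟩

theorem nonempty_equiv_baseChangeRep_self {G V : Type*} [Group G] [AddCommGroup V] [Module ℚ V]
    (ρ : Representation ℚ G V) : Nonempty (ρ.Equiv (baseChangeRep ℚ ρ)) := by
  refine ⟨Representation.Equiv.mk (TensorProduct.lid ℚ V).symm fun g => LinearMap.ext fun v => ?_⟩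
  exact (baseChangeRep_apply_tmul ℚ ρ g 1 v).symm

theorem actsBySign_baseChange_uliftRep (K : Type*) [Field K] [Algebra ℚ K] {G V : Type*} [Group G]
    [AddCommGroup V] [Module ℚ V] {ρ : Representation ℚ G V} {ε : G →* ℤˣ} (h : ActsBySign ρ ε) :
    ActsBySign (baseChangeRep K (uliftRep.{_, w} ρ)) ε := by
  intro g w
  induction w using TensorProduct.induction_on with
  | zero => rw [map_zero, smul_zero]
  | add x y hx hy => rw [map_add, hx, hy, smul_add]
  | tmul c v =>
    have h1 : uliftRep.{_, w} ρ g v = ε g • v := by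
      apply ULift.down_injective
      exact h g v.down
    rw [baseChangeRep_apply_tmul, h1, Units.smul_def, Units.smul_def, ← TensorProduct.mk_apply,
      map_zsmul, TensorProduct.mk_apply]

theorem finrank_baseChange_ulift (K : Type*) [Field K] [Algebra ℚ K] :
    Module.finrank K (K ⊗[ℚ] ULift.{w} ℚ) = 1 := by
  rw [Module.finrank_baseChange, ULift.moduleEquiv.finrank_eq, Module.finrank_self]

/-- The sign character of `G` attached to an index of a one-dimensional member of
`rationalFamily`. -/
noncomputable def linearSign {G : Type*} [Group G] :
    Hyperplane 2 (Abelianization G) ⊕ Unit → (G →* ℤˣ) :=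
  Sum.elim (fun y => (indexTwoSign y.1 y.2).comp Abelianization.of) fun _ => 1

theorem linearSign_injective {G : Type*} [Group G] :
    Function.Injective (linearSign (G := G)) := by
  have hsurj : Function.Surjective (Abelianization.of : G →* Abelianization G) :=
    QuotientGroup.mk_surjective
  have hne : ∀ y : Hyperplane 2 (Abelianization G), linearSign (Sum.inl y) ≠ 1 := by
    intro y h
    have h1 : y.1 = ⊤ := by
      rw [Subgroup.eq_top_iff']
      intro a
      obtain ⟨g, rfl⟩ := hsurj a
      exact (indexTwoSign_eq_one_iff y.2).1 (DFunLike.congr_fun h g)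
    have h2 := y.2
    rw [h1, Subgroup.index_top] at h2
    omega
  rintro (y | ⟨⟩) (y' | ⟨⟩) h
  · congr 1
    apply Subtype.ext
    ext a
    obtain ⟨g, rfl⟩ := hsurj a
    have h1 : indexTwoSign y.1 y.2 (Abelianization.of g) =
      indexTwoSign y'.1 y'.2 (Abelianization.of g) := DFunLike.congr_fun h g
    rw [← indexTwoSign_eq_one_iff y.2, ← indexTwoSign_eq_one_iff y'.2, h1]
  · exact absurd h (hne y)
  · exact absurd h.symm (hne y')
  · rfl

theorem exists_linearSign_eq {G : Type*} [Group G] (ε : G →* ℤˣ) : ∃ i, linearSign i = ε := by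
  by_cases hε : ε = 1
  · exact ⟨Sum.inr (), hε.symm⟩
  · let ε' : Abelianization G →* ℤˣ := Abelianization.lift ε
    have h1 : ε' ≠ 1 := by
      intro h
      refine hε (MonoidHom.ext fun g => ?_)
      rw [← Abelianization.lift_apply_of ε g]
      exact DFunLike.congr_fun h _
    refine ⟨Sum.inl ⟨ε'.ker, index_ker_of_sign_ne_one h1⟩, sign_ext fun g => ?_⟩
    refine (indexTwoSign_eq_one_iff (index_ker_of_sign_ne_one h1)).trans ?_
    rw [MonoidHom.mem_ker, Abelianization.lift_apply_of]

theorem charRep_actsBySign {A : Type*} [Group A] (hA : ∀ a : A, a * a = 1) (y : Hyperplane 2 A)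
    {φ : A →* ℚˣ} (hφ : φ.ker = y.1) : ActsBySign (charRep ℚ φ) (indexTwoSign y.1 y.2) := by
  intro a q
  have h1 : (φ a : ℚ) = (indexTwoSign y.1 y.2 a : ℤ) := by
    rcases Int.units_eq_one_or (indexTwoSign y.1 y.2 a) with h | h
    · have h2 : a ∈ φ.ker := hφ ▸ (indexTwoSign_eq_one_iff y.2).1 h
      rw [h, MonoidHom.mem_ker.1 h2]
      simp
    · have h2 : φ a ≠ 1 := by
        intro h2
        have h3 : a ∈ φ.ker := h2
        rw [hφ, ← indexTwoSign_eq_one_iff y.2, h] at h3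
        exact absurd h3 (by decide)
      have h3 := congrArg Units.val (map_mul φ a a)
      rw [hA, map_one, Units.val_one, Units.val_mul] at h3
      rw [h, (mul_self_eq_one_iff.1 h3.symm).resolve_left fun h4 => h2 (Units.ext h4)]
      simp
  change (φ a : ℚ) * q = _
  rw [h1, Units.smul_def, zsmul_eq_mul]

/-- Applied to the center, this supplies an `x`; without one, irreducibility of the family would say
nothing about `K`. -/
theorem nonempty_hyperplane_of_isPGroup {p : ℕ} [Fact p.Prime] {A : Type*} [Group A] [Finite A]
    (hA : IsPGroup p A) (hnt : Nontrivial A) : Nonempty (Hyperplane p A) := by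
  obtain ⟨n, hn⟩ := IsPGroup.iff_card.1 hA
  obtain ⟨m, rfl⟩ : ∃ m, n = m + 1 := by
    refine Nat.exists_eq_succ_of_ne_zero ?_
    rintro rfl
    rw [pow_zero] at hn
    exact absurd hn (Finite.one_lt_card (α := A)).ne'
  obtain ⟨x, hx⟩ := Sylow.exists_subgroup_card_pow_prime p
    (hn ▸ pow_dvd_pow p m.le_succ : p ^ m ∣ Nat.card A)
  refine ⟨⟨x, ?_⟩⟩
  have h1 := x.card_mul_index
  rw [hx, hn, pow_succ] at h1
  exact Nat.eq_of_mul_eq_mul_left (pow_pos (Fact.out : p.Prime).pos m) h1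

end BasicSet

/-! ### The classification over a field of characteristic zero. -/

section Main

open Representation

variable {G : Type u} [Group G] {H : Subgroup G}
  {χ : Hyperplane 2 (Subgroup.center G) → (H →* GaussianFieldˣ)}
  {φ : Hyperplane 2 (Abelianization G) → (Abelianization G →* ℚˣ)}
  (hφ : ∀ y, (φ y).ker = y.1) (hA : ∀ a : Abelianization G, a * a = 1)

include hφ hA

theorem rationalFamily_inr (K : Type v) [Field K] [Algebra ℚ K]
    (i : Hyperplane 2 (Abelianization G) ⊕ Unit) :
    ActsBySign (extendScalars K (rationalFamily χ φ (Sum.inr i))).ρ (linearSign i) ∧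
      Module.finrank K (extendScalars K (rationalFamily χ φ (Sum.inr i))).V = 1 := by
  rcases i with y | ⟨⟩
  · refine ⟨actsBySign_baseChange_uliftRep K fun g q => ?_, finrank_baseChange_ulift K⟩
    exact charRep_actsBySign hA y (hφ y) (Abelianization.of g) q
  · refine ⟨actsBySign_baseChange_uliftRep K fun g q => ?_, finrank_baseChange_ulift K⟩
    exact (one_smul ℤˣ q).symm

omit hφ hA in
theorem linearSign_center (hcomm : commutator G = Subgroup.center G)
    (i : Hyperplane 2 (Abelianization G) ⊕ Unit) (z : Subgroup.center G) :
    linearSign i (z : G) = 1 :=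
  Abelianization.commutator_subset_ker (linearSign i) (by rw [hcomm]; exact z.2)

variable (hpol : ∀ x, ∃ (lam : Subgroup.center G →* ℤˣ) (β : G →* G →* ℤˣ) (N : Subgroup G) (h₀ g₀ : G),
    (∀ z, lam z = 1 ↔ z ∈ x.1) ∧ IsQuaternionicPolarization lam β N h₀ g₀ ∧
      IsPolarizingCharacter lam N h₀ (χ x))
  (hcomm : commutator G = Subgroup.center G)

include hpol hcomm

/-- The center acts on an irreducible representation by a sign character. A nontrivial one has a
hyperplane `x` as kernel and forces `2V_x`; a trivial one leaves an action of `Gᵃᵇ`, again by signs.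
The same signs tell the members of the family apart. -/
theorem isBasicSet_extendScalars [Finite G] (hZ : ∀ z : Subgroup.center G, z * z = 1)
    (K : Type v) [Field K] [Algebra ℚ K]
    (hK : ¬ ∃ t₀ t₁ t₂ : K, (t₀, t₁, t₂) ≠ (0, 0, 0) ∧ t₀ ^ 2 + t₁ ^ 2 + t₂ ^ 2 = 0) :
    IsBasicSet (fun i => extendScalars K (rationalFamily χ φ i)) := by
  have : CharZero K := algebraRat.charZero K
  have hinr := rationalFamily_inr (χ := χ) hφ hA K
  choose lam β N h₀ g₀ hlam hP hχ using hpol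
  have hsign : ∀ x, HasCentralSign (extendScalars K (rationalFamily χ φ (Sum.inl x))).ρ (lam x) :=
    fun x => baseChangeRep_hasCentralSign K (hχ x).indCharRep_hasCentralSign
  have hirr : ∀ i, (extendScalars K (rationalFamily χ φ i)).ρ.IsIrreducible := by
    rintro (x | i)
    · exact ((hχ x).baseChange_isIrreducible_iff (hP x) K).2 hK
    · exact isIrreducible_of_finrank_eq_one (hinr i).2
  have hsep : ∀ x i, Nonempty ((extendScalars K (rationalFamily χ φ (Sum.inl x))).ρ.Equiv
      (extendScalars K (rationalFamily χ φ (Sum.inr i))).ρ) → False := by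
    rintro x i ⟨e⟩
    have := (isIrreducible_iff_forall.1 (hirr (Sum.inl x))).1
    have h1 : x.1 = ⊤ := by
      rw [Subgroup.eq_top_iff']
      intro z
      rw [← hlam, ← linearSign_center hcomm i z]
      exact sign_eq_of_equiv e (hsign x z) ((hinr i).1 z)
    have h2 := x.2
    rw [h1, Subgroup.index_top] at h2
    omega
  refine ⟨?_, hirr, ?_, ?_⟩
  · rintro (x | i)
    · exact Module.finite_def.2 (Submodule.fg_def.2 ⟨_, Set.finite_range _,
        baseChangeRep_span K (hχ x).indCharRep_span⟩)
    · exact Module.finite_of_finrank_eq_succ (hinr i).2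
  · rintro (x | i) (x' | i') ⟨e⟩
    · have := (isIrreducible_iff_forall.1 (hirr (Sum.inl x))).1
      congr 1
      apply Subtype.ext
      ext z
      rw [← hlam, ← hlam, sign_eq_of_equiv e (hsign x z) (hsign x' z)]
    · exact (hsep x i' ⟨e⟩).elim
    · exact (hsep x' i ⟨e.symm⟩).elim
    · have := (isIrreducible_iff_forall.1 (hirr (Sum.inr i))).1
      congr 1
      apply linearSign_injective
      ext g : 1
      exact sign_eq_of_equiv e ((hinr i).1 g) ((hinr i').1 g)
  · intro W _ _ _ σ hσ
    obtain ⟨lamW, hlamW⟩ := exists_sign_of_isIrreducible hσ (Subgroup.center G).subtype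
      (fun z w => by
        rw [← Module.End.mul_apply, ← map_mul, ← map_mul, hZ, map_one, map_one,
          Module.End.one_apply])
      fun z g w => by
        rw [← Module.End.mul_apply, ← map_mul, ← Module.End.mul_apply (σ g), ← map_mul]
        exact congrArg (fun a => σ a w) (Subgroup.mem_center_iff.1 z.2 g).symm
    by_cases h1 : lamW = 1
    · have hz : ∀ z ∈ Subgroup.center G, ∀ w, σ z w = w := fun z hz w => by
        have h2 := hlamW ⟨z, hz⟩ w
        rw [h1, MonoidHom.one_apply, one_smul] at h2
        exact h2
      have hmem : ∀ g : G, Abelianization.of g = 1 → g ∈ Subgroup.center G := fun g hg => by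
        rw [← hcomm]
        exact (QuotientGroup.eq_one_iff g).1 hg
      obtain ⟨ε, hε⟩ := exists_sign_of_isIrreducible hσ (MonoidHom.id G)
        (fun g w => by
          rw [MonoidHom.id_apply, ← Module.End.mul_apply, ← map_mul]
          exact hz _ (hmem _ (by rw [map_mul, hA])) w)
        fun g g' w => by
          have h2 := hz (g * g' * (g' * g)⁻¹)
            (hmem _ (by rw [map_mul, map_inv, map_mul, map_mul, mul_comm, mul_comm
              (Abelianization.of g), inv_mul_cancel])) (σ (g' * g) w)
          rw [← Module.End.mul_apply, ← map_mul, inv_mul_cancel_right, map_mul, map_mul] at h2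
          exact h2
      obtain ⟨i, rfl⟩ := exists_linearSign_eq ε
      have hact : ActsBySign σ (linearSign i) := hε
      exact ⟨Sum.inr i, hact.nonempty_equiv (hinr i).1 (hact.finrank_eq_one hσ) (hinr i).2⟩
    · let x : Hyperplane 2 (Subgroup.center G) := ⟨lamW.ker, index_ker_of_sign_ne_one h1⟩
      have h2 : lam x = lamW := sign_ext fun z => hlam x z
      have h3 : HasCentralSign σ (lam x) := by
        rw [h2]
        exact hlamW
      exact ⟨Sum.inl x, (hχ x).nonempty_equiv_baseChange (hP x) K hK h3 hσ⟩

end Main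

theorem mainTheorem11
    {F : Type*} [Field F] [Finite F] [CharP F 2]
    {G : Type u} [Group G] [Finite G]
    (hG : IsSpecialPGroup 2 G)
    (hord : ∀ g : G, g ∉ Subgroup.center G → orderOf g = 4)
    [Module F (Additive (Subgroup.center G))] [Module F (Additive (Abelianization G))]
    (hdim : Module.finrank F (Additive (Subgroup.center G)) = 1)
    (B : Additive (Abelianization G) →ₗ[F] Additive (Abelianization G) →ₗ[F]
      Additive (Subgroup.center G))
    (hB : ∀ a b : G,
      ((B (Additive.ofMul (Abelianization.of a)) (Additive.ofMul (Abelianization.of b))).toMul : G)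
        = a * b * a⁻¹ * b⁻¹)
    (L : Submodule F (Additive (Abelianization G))) (hL : IsLagrangian B L)
    (χ : Hyperplane 2 (Subgroup.center G) → (abPreimage L →* GaussianFieldˣ))
    (hχ : ∀ x, ((χ x).comp (Subgroup.inclusion (hG.center_le L))).ker = x.1)
    (φ : Hyperplane 2 (Abelianization G) → (Abelianization G →* ℚˣ))
    (hφ : ∀ y, (φ y).ker = y.1) :
    IsBasicSet (rationalFamily χ φ) ∧
    (∀ x, Nonempty ((repTwoV (χ x)).ρ.IntertwiningMap (repTwoV (χ x)).ρ ≃ₐ[ℚ] ℍ[ℚ, -1, -1])) ∧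
    ∀ (K : Type v) [Field K] [Algebra ℚ K],
      IsBasicSet (fun i => extendScalars K (rationalFamily χ φ i)) ↔
        ¬ ∃ t₀ t₁ t₂ : K, (t₀, t₁, t₂) ≠ (0, 0, 0) ∧ t₀ ^ 2 + t₁ ^ 2 + t₂ ^ 2 = 0 := by
  have hpol := fun x => hG.exists_polarization hord hdim hB hL x (χ x) (hχ x)
  have hA : ∀ a : Abelianization G, a * a = 1 := fun a =>
    add_self_of_charP_two (F := F) (Additive.ofMul a)
  have hZ : ∀ z : Subgroup.center G, z * z = 1 := center_mul_self (F := F)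
  refine ⟨?_, fun x => ?_, fun K _ _ => ⟨fun h => ?_, fun hK => ?_⟩⟩
  · exact (isBasicSet_extendScalars hφ hA hpol hG.commutator_eq hZ ℚ
      rat_three_squares_anisotropic).of_equiv fun i => nonempty_equiv_baseChangeRep_self _
  · obtain ⟨lam, β, N, h₀, g₀, -, hP, hχ'⟩ := hpol x
    exact hχ'.nonempty_algEquiv hP
  -- Irreducibility of a single `K ⊗ 2V_x` already excludes an isotropic sum of three squares.
  · obtain ⟨x⟩ := nonempty_hyperplane_of_isPGroup (hG.isPGroup.to_subgroup (Subgroup.center G)) <| by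
      have : Nontrivial (Additive (Subgroup.center G)) :=
        Module.nontrivial_of_finrank_pos (R := F) (hdim ▸ one_pos)
      exact this
    obtain ⟨lam, β, N, h₀, g₀, -, hP, hχ'⟩ := hpol x
    exact (hχ'.baseChange_isIrreducible_iff hP K).1 (h.irreducible (Sum.inl x))
  · exact isBasicSet_extendScalars hφ hA hpol hG.commutator_eq hZ K hK
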